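/- Let $F$ be a field of characteristic zero. A Lie triple system over $F$ is a vector space $T$ with a trilinear product $[x,y,z]$ such that $[x,x,y]=0$, $[x,y,z]+[y,z,x]+[z,x,y]=0$ and $[a,b,[x,y,z]]=[[a,b,x],y,z]+[x,[a,b,y],z]+[x,y,[a,b,z]]$. Write $(x,y,z)=(xy)z-x(yz)$ for the associator of a nonassociative algebra. The universal enveloping algebra $U(T)$ is the unital nonassociative $F$-algebra with a linear map $\iota\colon T\to U(T)$ that is universal among linear maps $\iota\colon T\to A$ into unital nonassociative algebras $A$ satisfying, for all $a,b,c\in T$ and $x,y\in A$: $(\iota(a),x,y)=-(x,\iota(a),y)$; $\iota([a,b,c])=\iota(a)(\iota(b)\iota(c))-\iota(b)(\iota(a)\iota(c))-\iota(c)(\iota(a)\iota(b))+\iota(c)(\iota(b)\iota(a))$; and $\iota(a)\iota(b)=\iota(b)\iota(a)$. Its augmentation ideal is the kernel of the unital algebra homomorphism $\varepsilon\colon U(T)\to F$ with $\varepsilon\circ\iota=0$. A right ideal is a subspace $I$ with $I\,U(T)\subseteq I$; here it is called proper if $I\neq 0$ and $I\neq U(T)$. Let $S_2$ be the two-dimensional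 Lie triple system over $F$ with basis $e,f$ and product determined by $[e,f,e]=2e$ and $[e,f,f]=-2f$. Write $e,f$ also for $\iota(e),\iota(f)\in U(S_2)$, and set $e^0=1$, $e^{n+1}=e\,e^n$. Then: 1. $(e^n,f,f)\,e = n\,e^n f - n(n-1)\,e^{n-1}$ in $U(S_2)$ for all integers $n\ge 0$ (for $n=0$ the right-hand side is $0$). 2. The only proper right ideal of $U(S_2)$ is its augmentation ideal; that is, a subset $I$ of $U(S_2)$ is a right ideal with $0\neq I\neq U(S_2)$ if and only if $I=\ker\varepsilon$. -/

import Mathlib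

/-- A Lie triple system over `F`: a module with a trilinear product `[x, y, z]` such that
`[x,x,y] = 0`, `[x,y,z] + [y,z,x] + [z,x,y] = 0`, and every `[a,b,-]` is a derivation. -/
class LieTripleSystem (F : Type*) (T : Type*) [Field F] [AddCommGroup T] [Module F T] where
  /-- the triple product -/
  bracket : T →ₗ[F] T →ₗ[F] T →ₗ[F] T
  bracket_self : ∀ x y : T, bracket x x y = 0
  bracket_cyclic : ∀ x y z : T, bracket x y z + bracket y z x + bracket z x y = 0
  bracket_derivation : ∀ a b x y z : T,
    bracket a b (bracket x y z) =
      bracket (bracket a b x) y z + bracket x (bracket a b y) z + bracket x y (bracket a b z)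

section Nonassociative

/-- The generalized left alternative nucleus
`{a | (a,x,y) = -(x,a,y) for all x, y}` of a nonassociative algebra. -/
def leftAltNucleus (A : Type*) [NonAssocRing A] : Set A :=
  {a | ∀ x y : A, associator a x y = -associator x a y}

/-- The triple product `a(bc) - b(ac) - c(ab) + c(ba)`. -/
def tripleProduct {A : Type*} [NonAssocRing A] (a b c : A) : A :=
  a * (b * c) - b * (a * c) - c * (a * b) + c * (b * a)

/-- Powers in a nonassociative unital algebra: `x ^ 0 = 1` and `x ^ (n + 1) = x * x ^ n`. -/
def naPow {A : Type*} [NonAssocRing A] (x : A) : ℕ → A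
  | 0 => 1
  | n + 1 => x * naPow x n

/-- A right ideal of a nonassociative `F`-algebra: a subspace `I` with `I A ⊆ I`. -/
def IsRightIdeal {F A : Type*} [Field F] [NonAssocRing A] [Module F A] (I : Submodule F A) : Prop :=
  ∀ x ∈ I, ∀ a : A, x * a ∈ I

/-- The linear maps from a Lie triple system `T` to a unital nonassociative algebra `A` which are
homomorphisms of Lie triple systems into the generalized left alternative nucleus of `A` and whose
values commute with each other. -/
structure IsSpecialMap {F T A : Type*} [Field F] [AddCommGroup T] [Module F T]
    [LieTripleSystem F T] [NonAssocRing A] [Module F A] (j : T →ₗ[F] A) : Prop where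
  mem_leftAltNucleus : ∀ a : T, j a ∈ leftAltNucleus A
  map_bracket : ∀ a b c : T,
    j (LieTripleSystem.bracket (F := F) a b c) = tripleProduct (j a) (j b) (j c)
  comm : ∀ a b : T, j a * j b = j b * j a

end Nonassociative

noncomputable section Enveloping

/-- The free unital nonassociative `F`-algebra on the set `T`: the algebra of the free unital
magma on `T`. -/
abbrev FreeUnitalNonAssocAlgebra (F T : Type*) [Field F] : Type _ :=
  MonoidAlgebra F (WithOne (FreeMagma T))

/-- The generator attached to an element of `T`. -/
def freeGen (F : Type*) {T : Type*} [Field F] (a : T) : FreeUnitalNonAssocAlgebra F T :=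
  MonoidAlgebra.single (FreeMagma.of a : WithOne (FreeMagma T)) 1

/-- The defining relations of the universal enveloping algebra of a Lie triple system. -/
inductive EnvelopingRel (F T : Type*) [Field F] [AddCommGroup T] [Module F T]
    [LieTripleSystem F T] :
    FreeUnitalNonAssocAlgebra F T → FreeUnitalNonAssocAlgebra F T → Prop
  | add (a b : T) : EnvelopingRel F T (freeGen F (a + b)) (freeGen F a + freeGen F b)
  | smul (r : F) (a : T) : EnvelopingRel F T (freeGen F (r • a)) (r • freeGen F a)
  | leftAlt (a : T) (x y : FreeUnitalNonAssocAlgebra F T) :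
      EnvelopingRel F T (associator (freeGen F a) x y) (-associator x (freeGen F a) y)
  | bracket (a b c : T) :
      EnvelopingRel F T (freeGen F (LieTripleSystem.bracket (F := F) a b c))
        (tripleProduct (freeGen F a) (freeGen F b) (freeGen F c))
  | comm (a b : T) :
      EnvelopingRel F T (freeGen F a * freeGen F b) (freeGen F b * freeGen F a)

/-- The universal enveloping algebra `U(T)` of a Lie triple system `T`: the quotient of the free
unital nonassociative algebra on `T` by the congruence generated by the defining relations. Its
universal property is `EnvelopingAlgebra.existsUnique_lift`. -/
def EnvelopingAlgebra (F T : Type*) [Field F] [AddCommGroup T] [Module F T]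
    [LieTripleSystem F T] : Type _ :=
  (ringConGen (EnvelopingRel F T)).Quotient

namespace EnvelopingAlgebra

variable {F T : Type*} [Field F] [AddCommGroup T] [Module F T] [LieTripleSystem F T]

instance : NonAssocRing (EnvelopingAlgebra F T) :=
  inferInstanceAs (NonAssocRing (ringConGen (EnvelopingRel F T)).Quotient)

instance : DistribMulAction F (EnvelopingAlgebra F T) :=
  inferInstanceAs (DistribMulAction F (ringConGen (EnvelopingRel F T)).Quotient)

instance : IsScalarTower F (EnvelopingAlgebra F T) (EnvelopingAlgebra F T) :=
  inferInstanceAs (IsScalarTower F (ringConGen (EnvelopingRel F T)).Quotient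
    (ringConGen (EnvelopingRel F T)).Quotient)

instance : SMulCommClass F (EnvelopingAlgebra F T) (EnvelopingAlgebra F T) :=
  inferInstanceAs (SMulCommClass F (ringConGen (EnvelopingRel F T)).Quotient
    (ringConGen (EnvelopingRel F T)).Quotient)

/-- The quotient map from the free algebra. -/
def mk (x : FreeUnitalNonAssocAlgebra F T) : EnvelopingAlgebra F T :=
  (ringConGen (EnvelopingRel F T)).mk' x

theorem mk_surjective : Function.Surjective (mk (F := F) (T := T)) :=
  (ringConGen (EnvelopingRel F T)).mk'_surjective

theorem mk_zero : mk (0 : FreeUnitalNonAssocAlgebra F T) = 0 := rfl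
theorem mk_one : mk (1 : FreeUnitalNonAssocAlgebra F T) = 1 := rfl
theorem mk_add (x y : FreeUnitalNonAssocAlgebra F T) : mk (x + y) = mk x + mk y := rfl
theorem mk_sub (x y : FreeUnitalNonAssocAlgebra F T) : mk (x - y) = mk x - mk y := rfl
theorem mk_neg (x : FreeUnitalNonAssocAlgebra F T) : mk (-x) = -mk x := rfl
theorem mk_mul (x y : FreeUnitalNonAssocAlgebra F T) : mk (x * y) = mk x * mk y := rfl
theorem mk_smul (r : F) (x : FreeUnitalNonAssocAlgebra F T) : mk (r • x) = r • mk x := rfl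

theorem mk_eq_of_rel {x y : FreeUnitalNonAssocAlgebra F T} (h : EnvelopingRel F T x y) :
    mk x = mk y :=
  (RingCon.eq _).2 (RingConGen.Rel.of _ _ h)

instance : Module F (EnvelopingAlgebra F T) where
  add_smul r s x := by
    obtain ⟨x, rfl⟩ := mk_surjective x
    rw [← mk_smul, add_smul, mk_add, mk_smul, mk_smul]
  zero_smul x := by
    obtain ⟨x, rfl⟩ := mk_surjective x
    rw [← mk_smul, zero_smul, mk_zero]

variable (F) in
/-- The canonical map `T → U(T)`. -/
def ι : T →ₗ[F] EnvelopingAlgebra F T where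
  toFun a := mk (freeGen F a)
  map_add' a b := by rw [mk_eq_of_rel (.add a b), mk_add]
  map_smul' r a := by rw [mk_eq_of_rel (.smul r a), mk_smul, RingHom.id_apply]

theorem isSpecialMap_ι : IsSpecialMap (ι F : T →ₗ[F] EnvelopingAlgebra F T) where
  mem_leftAltNucleus a x y := by
    obtain ⟨x, rfl⟩ := mk_surjective x
    obtain ⟨y, rfl⟩ := mk_surjective y
    exact mk_eq_of_rel (.leftAlt a x y)
  map_bracket a b c := mk_eq_of_rel (.bracket a b c)
  comm a b := mk_eq_of_rel (.comm a b)

variable {A : Type*} [NonAssocRing A] [Module F A] [IsScalarTower F A A] [SMulCommClass F A A]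

/-- The homomorphism from the free algebra induced by a map `T → A`. -/
def freeLift (j : T → A) : FreeUnitalNonAssocAlgebra F T →ₙₐ[F] A :=
  MonoidAlgebra.liftMagma F (WithOne.lift (FreeMagma.lift j)).toMulHom

theorem freeLift_single (j : T → A) (m : WithOne (FreeMagma T)) (r : F) :
    freeLift j (MonoidAlgebra.single m r) = r • WithOne.lift (FreeMagma.lift j) m := by
  simp [freeLift, MonoidAlgebra.liftMagma]

theorem freeLift_gen (j : T → A) (a : T) : freeLift (F := F) j (freeGen F a) = j a := by
  rw [freeGen, freeLift_single, one_smul, WithOne.lift_coe, FreeMagma.lift_of]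

theorem freeLift_one (j : T → A) : freeLift (F := F) j 1 = 1 := by
  rw [MonoidAlgebra.one_def, freeLift_single, one_smul, map_one]

theorem freeLift_eq_of_con {j : T →ₗ[F] A} (hj : IsSpecialMap j)
    {x y : FreeUnitalNonAssocAlgebra F T} (h : ringConGen (EnvelopingRel F T) x y) :
    freeLift (F := F) j x = freeLift (F := F) j y := by
  change RingConGen.Rel _ x y at h
  induction h with
  | of x y h =>
    cases h with
    | add a b => simp [freeLift_gen]
    | smul r a => simp [freeLift_gen]
    | leftAlt a x y =>
      have := hj.mem_leftAltNucleus a (freeLift (F := F) j x) (freeLift (F := F) j y)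
      simpa [associator, freeLift_gen] using this
    | bracket a b c => simp [tripleProduct, freeLift_gen, hj.map_bracket]
    | comm a b => simp [freeLift_gen, hj.comm a b]
  | refl x => rfl
  | symm _ ih => exact ih.symm
  | trans _ _ ih₁ ih₂ => exact ih₁.trans ih₂
  | add _ _ ih₁ ih₂ => rw [map_add, map_add, ih₁, ih₂]
  | mul _ _ ih₁ ih₂ => rw [map_mul, map_mul, ih₁, ih₂]

/-- The homomorphism `U(T) → A` induced by a special map `T → A`. -/
def lift (j : T →ₗ[F] A) (hj : IsSpecialMap j) : EnvelopingAlgebra F T →ₙₐ[F] A where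
  toFun := Quotient.lift (freeLift (F := F) j) fun _ _ h => freeLift_eq_of_con hj h
  map_smul' r x := by
    obtain ⟨x, rfl⟩ := mk_surjective x
    exact map_smul (freeLift (F := F) j) r x
  map_zero' := map_zero (freeLift (F := F) j)
  map_add' x y := by
    obtain ⟨x, rfl⟩ := mk_surjective x
    obtain ⟨y, rfl⟩ := mk_surjective y
    exact map_add (freeLift (F := F) j) x y
  map_mul' x y := by
    obtain ⟨x, rfl⟩ := mk_surjective x
    obtain ⟨y, rfl⟩ := mk_surjective y
    exact map_mul (freeLift (F := F) j) x y

theorem lift_mk (j : T →ₗ[F] A) (hj : IsSpecialMap j) (x : FreeUnitalNonAssocAlgebra F T) :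
    lift j hj (mk x) = freeLift (F := F) j x := rfl

theorem lift_ι (j : T →ₗ[F] A) (hj : IsSpecialMap j) (a : T) : lift j hj (ι F a) = j a :=
  freeLift_gen j a

theorem lift_one (j : T →ₗ[F] A) (hj : IsSpecialMap j) : lift j hj 1 = 1 :=
  freeLift_one j

/-- The universal property of `U(T)`. -/
theorem existsUnique_lift (j : T →ₗ[F] A) (hj : IsSpecialMap j) :
    ∃! φ : EnvelopingAlgebra F T →ₙₐ[F] A, φ 1 = 1 ∧ ∀ a : T, φ (ι F a) = j a := by
  refine ⟨lift j hj, ⟨lift_one j hj, lift_ι j hj⟩, ?_⟩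
  rintro φ ⟨h1, hι⟩
  have key : ∀ m : FreeMagma T,
      φ (mk (MonoidAlgebra.single (m : WithOne (FreeMagma T)) 1)) =
        lift j hj (mk (MonoidAlgebra.single (m : WithOne (FreeMagma T)) 1)) := by
    intro m
    induction m using FreeMagma.recOnMul with
    | ih1 a => exact (hι a).trans (lift_ι j hj a).symm
    | ih2 x y hx hy =>
      have e : (MonoidAlgebra.single ((x * y : FreeMagma T) : WithOne (FreeMagma T)) (1 : F)) =
          MonoidAlgebra.single (x : WithOne (FreeMagma T)) 1 *
            MonoidAlgebra.single (y : WithOne (FreeMagma T)) 1 := by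
        rw [MonoidAlgebra.single_mul_single, one_mul, WithOne.coe_mul]
      rw [e, mk_mul, map_mul, map_mul, hx, hy]
  refine NonUnitalAlgHom.ext fun x => ?_
  obtain ⟨x, rfl⟩ := mk_surjective x
  induction x using MonoidAlgebra.induction_linear with
  | zero => rw [mk_zero, map_zero, map_zero]
  | add x y hx hy => rw [mk_add, map_add, map_add, hx, hy]
  | single m r =>
    have e : (MonoidAlgebra.single m r : FreeUnitalNonAssocAlgebra F T) =
        r • MonoidAlgebra.single m 1 := by simp
    rw [e, mk_smul, map_smul, map_smul]
    congr 1
    refine WithOne.cases_on m ?_ key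
    exact h1.trans (lift_one j hj).symm

variable (F T) in
/-- The counit `ε : U(T) → F`: the unital algebra homomorphism vanishing on `T`. -/
def counit : EnvelopingAlgebra F T →ₙₐ[F] F :=
  lift (0 : T →ₗ[F] F)
    { mem_leftAltNucleus := fun a x y => by simp [associator]
      map_bracket := fun a b c => by simp [tripleProduct]
      comm := fun a b => rfl }

variable (F T) in
/-- The augmentation ideal of `U(T)`: the kernel of the counit. -/
def augmentationIdeal : Submodule F (EnvelopingAlgebra F T) :=
  LinearMap.ker (counit F T : EnvelopingAlgebra F T →ₗ[F] F)

end EnvelopingAlgebra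

end Enveloping

noncomputable section TwoDimensional

/-- The underlying space of the two-dimensional Lie triple system `S₂`, with basis
`e = (1, 0)` and `f = (0, 1)`. -/
def S2 (F : Type*) : Type _ := F × F

namespace S2

variable {F : Type*} [Field F]

instance : AddCommGroup (S2 F) := inferInstanceAs (AddCommGroup (F × F))

instance : Module F (S2 F) := inferInstanceAs (Module F (F × F))

variable (F) in
/-- The first basis vector. -/
def e : S2 F := ((1, 0) : F × F)

variable (F) in
/-- The second basis vector. -/
def f : S2 F := ((0, 1) : F × F)

theorem add_fst (x y : S2 F) : (x + y).1 = x.1 + y.1 := rfl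
theorem add_snd (x y : S2 F) : (x + y).2 = x.2 + y.2 := rfl
theorem smul_fst (r : F) (x : S2 F) : (r • x).1 = r * x.1 := rfl
theorem smul_snd (r : F) (x : S2 F) : (r • x).2 = r * x.2 := rfl
theorem zero_fst : (0 : S2 F).1 = 0 := rfl
theorem zero_snd : (0 : S2 F).2 = 0 := rfl

/-- The triple product of `S₂`:
`[x, y, z] = (x₁ y₂ - x₂ y₁) (2 z₁ e - 2 z₂ f)`. It is the only trilinear product with
`[x,x,y] = 0`, `[e,f,e] = 2e` and `[e,f,f] = -2f`. -/
def triple (x y z : S2 F) : S2 F :=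
  ((2 * (x.1 * y.2 - x.2 * y.1) * z.1, -2 * (x.1 * y.2 - x.2 * y.1) * z.2) : F × F)

theorem triple_fst (x y z : S2 F) :
    (triple x y z).1 = 2 * (x.1 * y.2 - x.2 * y.1) * z.1 := rfl
theorem triple_snd (x y z : S2 F) :
    (triple x y z).2 = -2 * (x.1 * y.2 - x.2 * y.1) * z.2 := rfl

/-- The triple product of `S₂` as a trilinear map. -/
def tripleBracket : S2 F →ₗ[F] S2 F →ₗ[F] S2 F →ₗ[F] S2 F where
  toFun x :=
    { toFun := fun y =>
        { toFun := fun z => triple x y z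
          map_add' := fun z w => Prod.ext
            (by simp only [triple_fst, add_fst]; ring)
            (by simp only [triple_snd, add_snd]; ring)
          map_smul' := fun r z => Prod.ext
            (by simp only [triple_fst, smul_fst, RingHom.id_apply]; ring)
            (by simp only [triple_snd, smul_snd, RingHom.id_apply]; ring) }
      map_add' := fun y w => LinearMap.ext fun z =>
        show triple x (y + w) z = triple x y z + triple x w z from Prod.ext
        (by simp only [triple_fst, add_fst, add_snd]; ring)
        (by simp only [triple_snd, add_fst, add_snd]; ring)
      map_smul' := fun r y => LinearMap.ext fun z =>
        show triple x (r • y) z = r • triple x y z from Prod.ext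
        (by simp only [triple_fst, smul_fst, smul_snd]; ring)
        (by simp only [triple_snd, smul_fst, smul_snd]; ring) }
  map_add' x w := LinearMap.ext fun y => LinearMap.ext fun z =>
    show triple (x + w) y z = triple x y z + triple w y z from Prod.ext
    (by simp only [triple_fst, add_fst, add_snd]; ring)
    (by simp only [triple_snd, add_fst, add_snd]; ring)
  map_smul' r x := LinearMap.ext fun y => LinearMap.ext fun z =>
    show triple (r • x) y z = r • triple x y z from Prod.ext
    (by simp only [triple_fst, smul_fst, smul_snd]; ring)
    (by simp only [triple_snd, smul_fst, smul_snd]; ring)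

theorem tripleBracket_apply (x y z : S2 F) : tripleBracket x y z = triple x y z := rfl

instance : LieTripleSystem F (S2 F) where
  bracket := tripleBracket
  bracket_self x y := Prod.ext
    (by simp only [tripleBracket_apply, triple_fst, zero_fst]; ring)
    (by simp only [tripleBracket_apply, triple_snd, zero_snd]; ring)
  bracket_cyclic x y z := Prod.ext
    (by simp only [tripleBracket_apply, add_fst, triple_fst, zero_fst]; ring)
    (by simp only [tripleBracket_apply, add_snd, triple_snd, zero_snd]; ring)
  bracket_derivation a b x y z := Prod.ext
    (by simp only [tripleBracket_apply, add_fst, triple_fst, triple_snd]; ring)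
    (by simp only [tripleBracket_apply, add_snd, triple_fst, triple_snd]; ring)

theorem bracket_e_f_e : LieTripleSystem.bracket (F := F) (e F) (f F) (e F) = (2 : F) • e F :=
  Prod.ext (by change 2 * (1 * 1 - 0 * 0) * 1 = 2 * 1; ring)
    (by change -2 * (1 * 1 - 0 * 0) * 0 = 2 * 0; ring)

theorem bracket_e_f_f : LieTripleSystem.bracket (F := F) (e F) (f F) (f F) = (-2 : F) • f F :=
  Prod.ext (by change 2 * (1 * 1 - 0 * 0) * 0 = -2 * 0; ring)
    (by change -2 * (1 * 1 - 0 * 0) * 1 = -2 * 1; ring)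

end S2

end TwoDimensional

/-! Write `L_x` for left multiplication and `x∘y = xy + yx`. Membership of `b` in the generalized
left alternative nucleus says `L_{b∘x} = L_b L_x + L_x L_b`, and two such steps give `L_{[a,b,c]} =
[[L_a, L_b], L_c]`. Hence in `U(S₂)` the operators `L_e`, `L_f` generate a copy of `sl₂`, in which
`[L_e, L_f]` kills `1` and acts on `e^i f^j` by `2(i - j)`. All explicit formulas, including the
first claim, come from this normal ordering together with the Jordan rule.

The monomials `e^i f^j` form a basis. They span because degree is compatible with products: `2lx =
l∘x + [l,x]` for a generator `l`, and the commutator has lower degree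
(`IsS2Pair.monomialFiltration_le_boundedElements`). They are independent because `U(S₂)` maps to a
model with this basis, whose product is found by inverting a triangular symmetrization map
(`S2Model.symm₀_bijective`).

Modulo lower degree the product is that of polynomials, and `x ↦ (x,b,w)` is a first-order
differential operator (`IsS2Pair.associator_leftMonomial_sub_mem`): `(x,e,e)` has leading part `e
∂_f x`, and `(x,f,e)` has leading part `-e ∂_e x`. A right ideal is stable under these operators.
Take a nonzero element of least degree `N` in a right ideal without `1`. Repeated use of `(·,e,e)`
makes its leading term a multiple of `e^N`. Minimality then makes it an eigenvector of `(·,f,e)`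
with eigenvalue `-N`, so it is exactly a multiple of `e^N`. For `N ≥ 2` the first claim would put
`e^{N-1}` in the ideal, so `N = 1` and `e` lies in the ideal. Then so does `f = (e,f,f)`, and hence
the whole augmentation ideal, which has codimension one. -/

/-! ### Normal ordering in an `sl₂`-module generated by a spherical vector. -/

section SphericalModule

variable {F M : Type*} [Field F] [AddCommGroup M] [Module F M]

/-- The operators `E`, `D` and `[E, D]` satisfy the relations of `sl₂`, and `[E, D]` kills `v`. -/
structure IsSphericalVector (E D : Module.End F M) (v : M) : Prop where
  lie_e : (E * D - D * E) * E - E * (E * D - D * E) = (2 : F) • E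
  lie_f : (E * D - D * E) * D - D * (E * D - D * E) = (-2 : F) • D
  lie_apply : E (D v) = D (E v)

/-- The ordered monomial `Eⁱ Dʲ v`. -/
def orderedMonomial (E D : Module.End F M) (v : M) (i j : ℕ) : M :=
  (E ^ i) ((D ^ j) v)

namespace IsSphericalVector

variable {E D : Module.End F M} {v : M}

theorem apply_e_orderedMonomial (i j : ℕ) :
    E (orderedMonomial E D v i j) = orderedMonomial E D v (i + 1) j := by
  rw [orderedMonomial, orderedMonomial, pow_succ' E i, Module.End.mul_apply]

theorem apply_f_orderedMonomial_zero (j : ℕ) :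
    D (orderedMonomial E D v 0 j) = orderedMonomial E D v 0 (j + 1) := by
  simp [orderedMonomial, pow_succ' D j, Module.End.mul_apply]

variable (h : IsSphericalVector E D v)
include h

theorem lie_e_apply (x : M) :
    E (D (E x)) - D (E (E x)) = E (E (D x) - D (E x)) + (2 : F) • E x := by
  have := LinearMap.congr_fun h.lie_e x
  simp only [LinearMap.sub_apply, Module.End.mul_apply, LinearMap.smul_apply] at this
  rw [← this]; abel

theorem lie_f_apply (x : M) :
    E (D (D x)) - D (E (D x)) = D (E (D x) - D (E x)) - (2 : F) • D x := by
  have := LinearMap.congr_fun h.lie_f x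
  simp only [LinearMap.sub_apply, Module.End.mul_apply, LinearMap.smul_apply] at this
  rw [neg_smul] at this
  rw [sub_eq_add_neg _ ((2 : F) • D x), ← this]; abel

/-- The operator `[E, D]` kills `v`; each `E` raises its eigenvalue by `2` and each `D` lowers it by
`2`. -/
theorem lie_orderedMonomial (i j : ℕ) :
    E (D (orderedMonomial E D v i j)) - D (E (orderedMonomial E D v i j)) =
      (2 * ((i : F) - j)) • orderedMonomial E D v i j := by
  induction i with
  | zero =>
    induction j with
    | zero => simp [orderedMonomial, h.lie_apply]
    | succ j ih =>
      rw [← apply_f_orderedMonomial_zero, h.lie_f_apply, ih, map_smul]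
      push_cast; module
  | succ i ih =>
    rw [← apply_e_orderedMonomial, h.lie_e_apply, ih, map_smul]
    push_cast; module

/-- Moving `D` past the `i + 1` factors `E` costs the eigenvalue `2(k - j)` of `[E, D]` for each `k
= 0, …, i`; these add up to `(i + 1)(i - 2j)`. -/
theorem apply_f_orderedMonomial_succ (i j : ℕ) :
    D (orderedMonomial E D v (i + 1) j) = orderedMonomial E D v (i + 1) (j + 1) -
      (((i : F) + 1) * (i - 2 * j)) • orderedMonomial E D v i j := by
  induction i with
  | zero =>
    have := h.lie_orderedMonomial 0 j
    rw [apply_f_orderedMonomial_zero, apply_e_orderedMonomial, apply_e_orderedMonomial] at this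
    linear_combination (norm := (push_cast; module)) -this
  | succ i ih =>
    have := h.lie_orderedMonomial (i + 1) j
    rw [ih, map_sub, map_smul, apply_e_orderedMonomial, apply_e_orderedMonomial,
      apply_e_orderedMonomial] at this
    linear_combination (norm := (push_cast; module)) -this

end IsSphericalVector

end SphericalModule

/-! ### Operator identities for the generalized left alternative nucleus. -/

section JordanIdentities

variable {A : Type*} [NonAssocRing A]

/-- The nucleus condition in operator form, `L_{b∘x} = L_b L_x + L_x L_b`; it is used in this form
throughout. -/
theorem mul_add_mul_mul_of_mem_leftAltNucleus {b : A} (hb : b ∈ leftAltNucleus A) (x y : A) :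
    (b * x) * y + (x * b) * y = b * (x * y) + x * (b * y) := by
  have := hb x y
  simp only [associator] at this
  linear_combination (norm := module) this

/-- The triple product equals `a∘(b∘c) - b∘(a∘c)`, and applying the Jordan rule twice to each term
leaves `[[L_a, L_b], L_c]`. -/
theorem tripleProduct_mul {a b c : A} (ha : a ∈ leftAltNucleus A) (hb : b ∈ leftAltNucleus A)
    (x : A) :
    tripleProduct a b c * x =
      a * (b * (c * x)) - b * (a * (c * x)) - (c * (a * (b * x)) - c * (b * (a * x))) := by
  have h1 := mul_add_mul_mul_of_mem_leftAltNucleus hb c a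
  have h2 := mul_add_mul_mul_of_mem_leftAltNucleus ha c b
  have h3 := mul_add_mul_mul_of_mem_leftAltNucleus ha (b * c + c * b) x
  have h4 := mul_add_mul_mul_of_mem_leftAltNucleus hb (a * c + c * a) x
  have h5 := congrArg (a * ·) (mul_add_mul_mul_of_mem_leftAltNucleus hb c x)
  have h6 := congrArg (b * ·) (mul_add_mul_mul_of_mem_leftAltNucleus ha c x)
  have h7 := mul_add_mul_mul_of_mem_leftAltNucleus hb c (a * x)
  have h8 := mul_add_mul_mul_of_mem_leftAltNucleus ha c (b * x)
  have h9 := congrArg (· * x) h1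
  have h10 := congrArg (· * x) h2
  simp only [tripleProduct, mul_add, add_mul, sub_mul] at *
  linear_combination (norm := module) h3 - h4 + h5 - h6 + h7 - h8 - h9 + h10

/-- Drives the induction for leading terms of `(x,b,w)`: the only genuinely new contribution is
`y·[L_b, L_l]w`, the others involve associators with first entry `y`. -/
theorem associator_jordan {b l : A} (hl : l ∈ leftAltNucleus A) (hbl : b * l = l * b) (y w : A) :
    associator (l * y + y * l) b w = y * (b * (l * w) - l * (b * w)) + l * associator y b w +
      associator y b (l * w) - associator y b l * w := by
  have h1 := congrArg (· * w) (mul_add_mul_mul_of_mem_leftAltNucleus hl y b)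
  have h2 := mul_add_mul_mul_of_mem_leftAltNucleus hl y (b * w)
  have h3 := mul_add_mul_mul_of_mem_leftAltNucleus hl (y * b) w
  have h4 : (y * (b * l)) * w = (y * (l * b)) * w := by rw [hbl]
  simp only [associator, mul_sub, add_mul, sub_mul] at *
  linear_combination (norm := module) h1 - h2 + h3 - h4

/-- Expresses an associator through commutators, so that degree bounds on commutators become degree
bounds on associators. -/
theorem two_nsmul_associator {b : A} (hb : b ∈ leftAltNucleus A) (x w : A) :
    2 • associator x b w = b * (x * w) - x * (b * w) - (b * x - x * b) * w := by
  have h1 := mul_add_mul_mul_of_mem_leftAltNucleus hb x w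
  simp only [associator, sub_mul] at *
  linear_combination (norm := module) h1

end JordanIdentities

/-- A pair of elements satisfying the defining relations of `U(S₂)`. -/
structure IsS2Pair (F : Type*) {A : Type*} [Field F] [NonAssocRing A] [Module F A] (e f : A) :
    Prop where
  left_mem : e ∈ leftAltNucleus A
  right_mem : f ∈ leftAltNucleus A
  comm : e * f = f * e
  bracket_left : tripleProduct e f e = (2 : F) • e
  bracket_right : tripleProduct e f f = (-2 : F) • f

/-! ### The degree filtration and its compatibility with products. -/

section Filtration

variable {F A : Type*} [Field F] [NonAssocRing A] [Module F A] [IsScalarTower F A A]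
  [SMulCommClass F A A]

variable (F) in
/-- The monomial `e (e (⋯ (f (f ⋯))))` with `i` factors `e` and `j` factors `f`. -/
abbrev leftMonomial (e f : A) (i j : ℕ) : A :=
  orderedMonomial (LinearMap.mulLeft F e) (LinearMap.mulLeft F f) 1 i j

variable (F) in
/-- The span of the left monomials of degree less than `n`. -/
def monomialFiltration (e f : A) (n : ℕ) : Submodule F A :=
  Submodule.span F {x | ∃ i j, i + j < n ∧ leftMonomial F e f i j = x}

omit [IsScalarTower F A A] in
theorem leftMonomial_mem {e f : A} {i j n : ℕ} (h : i + j < n) :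
    leftMonomial F e f i j ∈ monomialFiltration F e f n :=
  Submodule.subset_span ⟨i, j, h, rfl⟩

omit [IsScalarTower F A A] in
theorem monomialFiltration_induction {e f : A} {n : ℕ} {S : Submodule F A} (φ : A →ₗ[F] A)
    (h : ∀ i j, i + j < n → φ (leftMonomial F e f i j) ∈ S) {x : A}
    (hx : x ∈ monomialFiltration F e f n) : φ x ∈ S := by
  have : monomialFiltration F e f n ≤ S.comap φ :=
    Submodule.span_le.2 (by rintro _ ⟨i, j, hij, rfl⟩; exact h i j hij)
  exact this hx

omit [IsScalarTower F A A] in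
theorem monomialFiltration_mono {e f : A} {m n : ℕ} (h : m ≤ n) :
    monomialFiltration F e f m ≤ monomialFiltration F e f n :=
  Submodule.span_le.2 (by rintro _ ⟨i, j, hij, rfl⟩; exact leftMonomial_mem (hij.trans_le h))

omit [IsScalarTower F A A] in
theorem monomialFiltration_zero {e f : A} : monomialFiltration F e f 0 = ⊥ :=
  Submodule.span_eq_bot.2 (by rintro _ ⟨i, j, hij, rfl⟩; omega)

omit [IsScalarTower F A A] in
theorem one_mem_monomialFiltration {e f : A} {n : ℕ} : (1 : A) ∈ monomialFiltration F e f (n + 1) :=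
  leftMonomial_mem (i := 0) (j := 0) (by omega)

omit [IsScalarTower F A A] in
theorem left_mul_leftMonomial (e f : A) (i j : ℕ) :
    e * leftMonomial F e f i j = leftMonomial F e f (i + 1) j :=
  IsSphericalVector.apply_e_orderedMonomial (E := LinearMap.mulLeft F e) i j

omit [IsScalarTower F A A] in
theorem right_mul_leftMonomial_zero (e f : A) (j : ℕ) :
    f * leftMonomial F e f 0 j = leftMonomial F e f 0 (j + 1) :=
  IsSphericalVector.apply_f_orderedMonomial_zero (D := LinearMap.mulLeft F f) j

namespace IsS2Pair

variable {e f : A} (h : IsS2Pair F e f)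
include h

omit [IsScalarTower F A A] [SMulCommClass F A A] in
theorem mem_leftAltNucleus {b : A} (hb : b = e ∨ b = f) : b ∈ leftAltNucleus A := by
  rcases hb with rfl | rfl
  exacts [h.left_mem, h.right_mem]

omit [IsScalarTower F A A] [SMulCommClass F A A] in
theorem commute {b l : A} (hb : b = e ∨ b = f) (hl : l = e ∨ l = f) : b * l = l * b := by
  rcases hb with rfl | rfl <;> rcases hl with rfl | rfl
  exacts [rfl, h.comm, h.comm.symm, rfl]

theorem isSphericalVector :
    IsSphericalVector (LinearMap.mulLeft F e) (LinearMap.mulLeft F f) 1 where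
  lie_e := LinearMap.ext fun x => by
    have := tripleProduct_mul (c := e) h.left_mem h.right_mem x
    rw [h.bracket_left, smul_mul_assoc] at this
    simp only [LinearMap.sub_apply, Module.End.mul_apply, LinearMap.smul_apply,
      LinearMap.mulLeft_apply, mul_sub]
    exact this.symm
  lie_f := LinearMap.ext fun x => by
    have := tripleProduct_mul (c := f) h.left_mem h.right_mem x
    rw [h.bracket_right, smul_mul_assoc] at this
    rw [LinearMap.smul_apply]
    simp only [LinearMap.sub_apply, Module.End.mul_apply, LinearMap.mulLeft_apply, mul_sub]
    exact this.symm
  lie_apply := by simpa using h.comm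

theorem lie_leftMonomial (i j : ℕ) :
    e * (f * leftMonomial F e f i j) - f * (e * leftMonomial F e f i j) =
      (2 * ((i : F) - j)) • leftMonomial F e f i j :=
  h.isSphericalVector.lie_orderedMonomial i j

theorem right_mul_leftMonomial_succ (i j : ℕ) :
    f * leftMonomial F e f (i + 1) j = leftMonomial F e f (i + 1) (j + 1) -
      (((i : F) + 1) * (i - 2 * j)) • leftMonomial F e f i j :=
  h.isSphericalVector.apply_f_orderedMonomial_succ i j

/-- The correction in normal ordering loses one `e` and one `f`, hence two degrees. -/
theorem right_mul_leftMonomial_sub_mem (i j : ℕ) :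
    f * leftMonomial F e f i j - leftMonomial F e f i (j + 1) ∈
      monomialFiltration F e f (i + j) := by
  cases i with
  | zero => rw [right_mul_leftMonomial_zero, sub_self]; exact zero_mem _
  | succ i =>
    rw [h.right_mul_leftMonomial_succ, sub_sub_cancel_left]
    exact neg_mem (Submodule.smul_mem _ _ (leftMonomial_mem (by omega)))

theorem generator_mul_mem {b : A} (hb : b = e ∨ b = f) {n : ℕ} {x : A}
    (hx : x ∈ monomialFiltration F e f n) : b * x ∈ monomialFiltration F e f (n + 1) := by
  refine monomialFiltration_induction (LinearMap.mulLeft F b) (fun i j hij => ?_) hx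
  rw [LinearMap.mulLeft_apply]
  rcases hb with rfl | rfl
  · rw [left_mul_leftMonomial]
    exact leftMonomial_mem (by omega)
  · rw [← sub_add_cancel (b * _) (leftMonomial F e b i (j + 1))]
    exact add_mem (monomialFiltration_mono (by omega) (h.right_mul_leftMonomial_sub_mem i j))
      (leftMonomial_mem (by omega))

/-- Each generator raises the degree by one, but `[L_e, L_f]` is diagonal on monomials, so
commutators of generators preserve it. -/
theorem lie_mem {b l : A} (hb : b = e ∨ b = f) (hl : l = e ∨ l = f) {n : ℕ} {x : A}
    (hx : x ∈ monomialFiltration F e f n) :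
    b * (l * x) - l * (b * x) ∈ monomialFiltration F e f n := by
  have key : e * (f * x) - f * (e * x) ∈ monomialFiltration F e f n := by
    refine monomialFiltration_induction
      (LinearMap.mulLeft F e * LinearMap.mulLeft F f - LinearMap.mulLeft F f * LinearMap.mulLeft F e)
      (fun i j hij => ?_) hx
    simp only [LinearMap.sub_apply, Module.End.mul_apply, LinearMap.mulLeft_apply]
    rw [h.lie_leftMonomial]
    exact Submodule.smul_mem _ _ (leftMonomial_mem hij)
  rcases hb with rfl | rfl <;> rcases hl with rfl | rfl
  · rw [sub_self]; exact zero_mem _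
  · exact key
  · rw [← neg_sub]; exact neg_mem key
  · rw [sub_self]; exact zero_mem _

end IsS2Pair

variable (F) in
/-- The elements whose left multiplication has degree at most `n` for the monomial filtration and
whose commutators with the left multiplications by `e` and `f` have degree at most `n - 1`. -/
def boundedElements (e f : A) (n : ℕ) : Submodule F A where
  carrier := {x | ∀ m, (∀ y ∈ monomialFiltration F e f m, x * y ∈ monomialFiltration F e f (n + m)) ∧
    ∀ y ∈ monomialFiltration F e f (m + 1), ∀ b, b = e ∨ b = f →
      b * (x * y) - x * (b * y) ∈ monomialFiltration F e f (n + m)}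
  zero_mem' m := by simp
  add_mem' {x z} hx hz m := by
    refine ⟨fun y hy => ?_, fun y hy b hb => ?_⟩
    · rw [add_mul]
      exact add_mem ((hx m).1 y hy) ((hz m).1 y hy)
    · convert add_mem ((hx m).2 y hy b hb) ((hz m).2 y hy b hb) using 1
      simp only [add_mul, mul_add]
      abel
  smul_mem' c x hx m := by
    refine ⟨fun y hy => ?_, fun y hy b hb => ?_⟩
    · rw [smul_mul_assoc]
      exact Submodule.smul_mem _ _ ((hx m).1 y hy)
    · convert Submodule.smul_mem _ c ((hx m).2 y hy b hb) using 1
      simp only [smul_mul_assoc, mul_smul_comm, smul_sub]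

theorem boundedElements_mono {e f : A} {m n : ℕ} (hmn : m ≤ n) :
    boundedElements F e f m ≤ boundedElements F e f n := fun _ hx k =>
  ⟨fun y hy => monomialFiltration_mono (by omega) ((hx k).1 y hy),
    fun y hy b hb => monomialFiltration_mono (by omega) ((hx k).2 y hy b hb)⟩

theorem commutator_mem_of_bounded {e f b : A} (hb : b = e ∨ b = f) {n : ℕ} {x : A}
    (hx : x ∈ boundedElements F e f n) : b * x - x * b ∈ monomialFiltration F e f n := by
  simpa using (hx 0).2 1 one_mem_monomialFiltration b hb

namespace IsS2Pair

variable {e f : A} (h : IsS2Pair F e f)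
include h

/-- Expand `L_{l∘x} = L_l L_x + L_x L_l`; the bracket with `L_b` acts on it as a derivation, and
each of the four resulting terms is controlled. -/
theorem jordan_mem_boundedElements {l : A} (hl : l = e ∨ l = f) {n : ℕ} {x : A}
    (hx : x ∈ boundedElements F e f n) : l * x + x * l ∈ boundedElements F e f (n + 1) := by
  have hj := mul_add_mul_mul_of_mem_leftAltNucleus (h.mem_leftAltNucleus hl) x
  intro m
  refine ⟨fun y hy => ?_, fun y hy b hb => ?_⟩
  · rw [add_mul, hj]
    refine add_mem ?_ ?_
    · exact monomialFiltration_mono (by omega) (h.generator_mul_mem hl ((hx m).1 y hy))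
    · exact monomialFiltration_mono (by omega) ((hx (m + 1)).1 _ (h.generator_mul_mem hl hy))
  · have h1 := h.lie_mem hb hl ((hx (m + 1)).1 y hy)
    have h2 := h.generator_mul_mem hl ((hx m).2 y hy b hb)
    have h3 := (hx (m + 1)).2 _ (h.generator_mul_mem hl hy) b hb
    have h4 := (hx (m + 1)).1 _ (h.lie_mem hb hl hy)
    have := add_mem (add_mem h1 (monomialFiltration_mono (by omega) h2)) (add_mem h3 h4)
    refine monomialFiltration_mono (m := n + (m + 1)) (by omega) ?_
    convert this using 1
    rw [add_mul, hj, add_mul, hj]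
    simp only [mul_add, mul_sub]
    abel

variable [CharZero F]

/-- A monomial of positive degree is `lx` with `l` a generator, and `2lx = l∘x + [l,x]`. The Jordan
part is bounded by the previous lemma, the commutator by induction. -/
theorem monomialFiltration_le_boundedElements (n : ℕ) :
    monomialFiltration F e f (n + 1) ≤ boundedElements F e f n := by
  induction n with
  | zero =>
    refine Submodule.span_le.2 ?_
    rintro _ ⟨i, j, hij, rfl⟩
    obtain ⟨rfl, rfl⟩ : i = 0 ∧ j = 0 := by omega
    intro m
    refine ⟨fun y hy => ?_, fun y hy b hb => ?_⟩
    · simpa [orderedMonomial] using hy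
    · simp [orderedMonomial]
  | succ n ih =>
    have step : ∀ l, l = e ∨ l = f → ∀ x ∈ monomialFiltration F e f (n + 1),
        l * x ∈ boundedElements F e f (n + 1) := by
      intro l hl x hx
      have h1 := h.jordan_mem_boundedElements hl (ih hx)
      -- Here `x` has degree at most `n` and `[l,x]` degree less than `n`, so the induction
      -- hypothesis applies to the commutator itself.
      have h2 := commutator_mem_of_bounded hl (ih hx)
      have h3 := boundedElements_mono n.le_succ (ih (monomialFiltration_mono n.le_succ h2))
      refine (Submodule.smul_mem_iff _ (two_ne_zero (α := F))).1 ?_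
      convert add_mem h1 h3 using 1
      module
    refine Submodule.span_le.2 ?_
    rintro _ ⟨i, j, hij, rfl⟩
    rcases i with - | i
    · rcases j with - | j
      · exact boundedElements_mono n.le_succ (ih (leftMonomial_mem (by omega)))
      · rw [← right_mul_leftMonomial_zero]
        exact step f (.inr rfl) _ (leftMonomial_mem (by omega))
    · rw [← left_mul_leftMonomial]
      exact step e (.inl rfl) _ (leftMonomial_mem (by omega))

theorem mul_mem {n m : ℕ} {x y : A} (hx : x ∈ monomialFiltration F e f (n + 1))
    (hy : y ∈ monomialFiltration F e f m) : x * y ∈ monomialFiltration F e f (n + m) :=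
  (h.monomialFiltration_le_boundedElements n hx m).1 y hy

theorem commutator_mem {b : A} (hb : b = e ∨ b = f) {n : ℕ} {x : A}
    (hx : x ∈ monomialFiltration F e f (n + 1)) :
    b * x - x * b ∈ monomialFiltration F e f n :=
  commutator_mem_of_bounded hb (h.monomialFiltration_le_boundedElements n hx)

theorem mul_mem' {n m : ℕ} {x y : A} (hx : x ∈ monomialFiltration F e f n)
    (hy : y ∈ monomialFiltration F e f (m + 1)) : x * y ∈ monomialFiltration F e f (n + m) := by
  cases n with
  | zero =>
    rw [monomialFiltration_zero, Submodule.mem_bot] at hx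
    rw [hx, zero_mul]
    exact zero_mem _
  | succ n => exact monomialFiltration_mono (by omega) (h.mul_mem hx hy)

/-- The products in `(x,b,w)` have degree up to `n + m + 1`; the associator loses at least two
degrees. -/
theorem associator_mem {b : A} (hb : b = e ∨ b = f) {n m : ℕ} {x w : A}
    (hx : x ∈ monomialFiltration F e f (n + 1)) (hw : w ∈ monomialFiltration F e f (m + 1)) :
    associator x b w ∈ monomialFiltration F e f (n + m) := by
  have h1 := (h.monomialFiltration_le_boundedElements n hx m).2 w hw b hb
  have h2 := h.mul_mem' (h.commutator_mem hb hx) hw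
  refine (Submodule.smul_mem_iff _ (two_ne_zero (α := F))).1 ?_
  convert sub_mem h1 h2 using 1
  rw [← two_nsmul_associator (h.mem_leftAltNucleus hb)]
  module

theorem associator_mem' {b : A} (hb : b = e ∨ b = f) {n m : ℕ} {x w : A}
    (hx : x ∈ monomialFiltration F e f n) (hw : w ∈ monomialFiltration F e f (m + 1)) :
    associator x b w ∈ monomialFiltration F e f (n - 1 + m) := by
  cases n with
  | zero =>
    rw [monomialFiltration_zero, Submodule.mem_bot] at hx
    rw [hx, associator, zero_mul, zero_mul, zero_mul, sub_zero]
    exact zero_mem _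
  | succ n => exact h.associator_mem hb hx hw

end IsS2Pair

end Filtration

/-! ### Leading terms of products and associators. -/

section Symbols

variable {F A : Type*} [Field F] [NonAssocRing A] [Module F A] [IsScalarTower F A A]
  [SMulCommClass F A A]

omit [IsScalarTower F A A] in
-- The factor `i` hides the truncated subtraction, which goes wrong only at `i = 0`.
theorem nat_smul_leftMonomial_left {e f : A} (i k j : ℕ) :
    (i : F) • leftMonomial F e f (i - 1 + (k + 1)) j = (i : F) • leftMonomial F e f (i + k) j := by
  cases i with
  | zero => simp
  | succ i => congr 2; omega

omit [IsScalarTower F A A] in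
theorem nat_smul_leftMonomial_right {e f : A} (i k j : ℕ) :
    (i : F) • leftMonomial F e f j (i - 1 + (k + 1)) = (i : F) • leftMonomial F e f j (i + k) := by
  cases i with
  | zero => simp
  | succ i => congr 2; omega

omit [IsScalarTower F A A] in
theorem leftMonomial_one_zero (e f : A) : leftMonomial F e f 1 0 = e := by
  simp [orderedMonomial]

omit [IsScalarTower F A A] in
theorem leftMonomial_zero_one (e f : A) : leftMonomial F e f 0 1 = f := by
  simp [orderedMonomial]

theorem associator_add_add_associator_sub (l y b w : A) :
    associator (l * y + y * l) b w + associator (l * y - y * l) b w =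
      2 • associator (l * y) b w := by
  simp only [associator, add_mul, sub_mul]
  module

namespace IsS2Pair

variable {e f : A} (h : IsS2Pair F e f)
include h

theorem generator_mul_mem_pred {b : A} (hb : b = e ∨ b = f) {n : ℕ} {x : A}
    (hx : x ∈ monomialFiltration F e f (n - 1)) : b * x ∈ monomialFiltration F e f n := by
  cases n with
  | zero =>
    rw [Nat.zero_sub, monomialFiltration_zero, Submodule.mem_bot] at hx
    rw [hx, mul_zero]
    exact zero_mem _
  | succ n => exact h.generator_mul_mem hb hx

variable [CharZero F]

/-- The associated graded algebra is a polynomial ring in two variables. Induct with `2(ly)w = l(yw)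
+ y(lw) + [l,y]w`, where the last term is of lower degree. -/
theorem leftMonomial_mul_sub_mem (i j k l : ℕ) :
    leftMonomial F e f i j * leftMonomial F e f k l - leftMonomial F e f (i + k) (j + l) ∈
      monomialFiltration F e f (i + j + k + l) := by
  induction hn : i + j generalizing i j k l with
  | zero =>
    obtain ⟨rfl, rfl⟩ : i = 0 ∧ j = 0 := by omega
    simp [orderedMonomial]
  | succ n ih =>
    refine (Submodule.smul_mem_iff _ (two_ne_zero (α := F))).1 ?_
    rcases i with - | i
    · rcases j with - | j
      · omega
      have h1 := mul_add_mul_mul_of_mem_leftAltNucleus h.right_mem (leftMonomial F e f 0 j)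
        (leftMonomial F e f k l)
      have h2 := h.mul_mem' (h.commutator_mem (.inr rfl)
        (leftMonomial_mem (F := F) (i := 0) (j := j) (n := j + 1) (by omega)))
        (leftMonomial_mem (F := F) (i := k) (j := l) (n := k + l + 1) (by omega))
      have h3 := h.generator_mul_mem (.inr rfl) (ih 0 j k l (by omega))
      have h4 := h.right_mul_leftMonomial_sub_mem (0 + k) (j + l)
      have h5 := ih 0 j k (l + 1) (by omega)
      have h6 := h.mul_mem (leftMonomial_mem (F := F) (i := 0) (j := j) (n := j + 1) (by omega))
        (h.right_mul_leftMonomial_sub_mem k l)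
      replace h2 := monomialFiltration_mono (n := n + 1 + k + l) (by omega) h2
      replace h3 := monomialFiltration_mono (n := n + 1 + k + l) (by omega) h3
      replace h4 := monomialFiltration_mono (n := n + 1 + k + l) (by omega) h4
      replace h5 := monomialFiltration_mono (n := n + 1 + k + l) (by omega) h5
      replace h6 := monomialFiltration_mono (n := n + 1 + k + l) (by omega) h6
      convert add_mem (add_mem (add_mem h2 h3) (add_mem h4 h5)) h6 using 1
      rw [show j + 1 + l = j + l + 1 by omega, show j + (l + 1) = j + l + 1 by omega,
        ← right_mul_leftMonomial_zero]
      simp only [sub_mul, mul_sub]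
      linear_combination (norm := module) h1
    · have h1 := mul_add_mul_mul_of_mem_leftAltNucleus h.left_mem (leftMonomial F e f i j)
        (leftMonomial F e f k l)
      have h2 := h.mul_mem' (h.commutator_mem (.inl rfl)
        (leftMonomial_mem (F := F) (i := i) (j := j) (n := i + j + 1) (by omega)))
        (leftMonomial_mem (F := F) (i := k) (j := l) (n := k + l + 1) (by omega))
      have h3 := h.generator_mul_mem (.inl rfl) (ih i j k l (by omega))
      have h5 := ih i j (k + 1) l (by omega)
      replace h2 := monomialFiltration_mono (n := n + 1 + k + l) (by omega) h2
      replace h3 := monomialFiltration_mono (n := n + 1 + k + l) (by omega) h3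
      replace h5 := monomialFiltration_mono (n := n + 1 + k + l) (by omega) h5
      convert add_mem (add_mem h2 h3) h5 using 1
      rw [show i + 1 + k = i + k + 1 by omega, show i + (k + 1) = i + k + 1 by omega,
        ← left_mul_leftMonomial e f i j, ← left_mul_leftMonomial e f k l,
        ← left_mul_leftMonomial e f (i + k)]
      simp only [sub_mul, mul_sub]
      linear_combination (norm := module) h1

set_option maxHeartbeats 1000000 in
/-- The leading term of `(x, b, w)`: it is given by the vector field attached to the operator
`[b, -]`, where `[b, e] = α [e, f]` and `[b, f] = β [e, f]`. -/
theorem associator_leftMonomial_sub_mem {b : A} (hb : b = e ∨ b = f) {α β : F}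
    (hα : ∀ x, b * (e * x) - e * (b * x) = α • (e * (f * x) - f * (e * x)))
    (hβ : ∀ x, b * (f * x) - f * (b * x) = β • (e * (f * x) - f * (e * x))) (i j k l : ℕ) :
    associator (leftMonomial F e f i j) b (leftMonomial F e f k l) -
      ((k : F) - l) • (α • (i : F) • leftMonomial F e f (i - 1 + k) (j + l) +
        β • (j : F) • leftMonomial F e f (i + k) (j - 1 + l)) ∈
      monomialFiltration F e f (i + j + (k + l) - 1) := by
  induction hn : i + j generalizing i j k l with
  | zero =>
    obtain ⟨rfl, rfl⟩ : i = 0 ∧ j = 0 := by omega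
    simp [orderedMonomial, associator]
  | succ n ih =>
    have hle : ∀ {N : ℕ} {x : A}, N ≤ n + (k + l) → x ∈ monomialFiltration F e f N →
        x ∈ monomialFiltration F e f (n + 1 + (k + l) - 1) := fun hN hx =>
      monomialFiltration_mono (by omega) hx
    refine (Submodule.smul_mem_iff _ (two_ne_zero (α := F))).1 ?_
    have hw : leftMonomial F e f k l ∈ monomialFiltration F e f (k + l + 1) :=
      leftMonomial_mem (by omega)
    -- products of monomials with the monomials appearing in a symbol
    have hsym : ∀ i j p q : ℕ, i + j ≤ n → p + q ≤ 1 →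
        ((p : F) - q) • (α • (i : F) • (leftMonomial F e f (i - 1 + p) (j + q) * leftMonomial F e f k l) +
          β • (j : F) • (leftMonomial F e f (i + p) (j - 1 + q) * leftMonomial F e f k l)) -
        ((p : F) - q) • (α • (i : F) • leftMonomial F e f (i - 1 + p + k) (j + q + l) +
          β • (j : F) • leftMonomial F e f (i + p + k) (j - 1 + q + l)) ∈
          monomialFiltration F e f (n + 1 + (k + l) - 1) := by
      intro i j p q hij hpq
      have h1 : (i : F) • (leftMonomial F e f (i - 1 + p) (j + q) * leftMonomial F e f k l -
          leftMonomial F e f (i - 1 + p + k) (j + q + l)) ∈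
          monomialFiltration F e f (n + 1 + (k + l) - 1) := by
        cases i with
        | zero => simp
        | succ i => exact Submodule.smul_mem _ _ (hle (by omega) (h.leftMonomial_mul_sub_mem _ _ _ _))
      have h2 : (j : F) • (leftMonomial F e f (i + p) (j - 1 + q) * leftMonomial F e f k l -
          leftMonomial F e f (i + p + k) (j - 1 + q + l)) ∈
          monomialFiltration F e f (n + 1 + (k + l) - 1) := by
        cases j with
        | zero => simp
        | succ j => exact Submodule.smul_mem _ _ (hle (by omega) (h.leftMonomial_mul_sub_mem _ _ _ _))
      convert Submodule.smul_mem _ ((p : F) - q) (add_mem (Submodule.smul_mem _ α h1)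
        (Submodule.smul_mem _ β h2)) using 1
      module
    rcases i with - | i
    · rcases j with - | j
      · omega
      have hy : leftMonomial F e f 0 j ∈ monomialFiltration F e f (n + 1) :=
        leftMonomial_mem (by omega)
      -- With `y = f^j`, write `2(fy,b,w) = (f∘y,b,w) + ([f,y],b,w)`: the first term is expanded
      -- here, the second is negligible by `h2`.
      have h1 := associator_jordan h.right_mem (h.commute hb (.inr rfl)) (leftMonomial F e f 0 j)
        (leftMonomial F e f k l)
      have h2 := hle (by omega) (h.associator_mem' hb (h.commutator_mem (.inr rfl) hy) hw)
      have h3 := hle (by omega) (h.leftMonomial_mul_sub_mem 0 j k l)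
      have h4 := hle le_rfl (h.generator_mul_mem_pred (.inr rfl) (ih 0 j k l (by omega)))
      have h5 := hle (by omega) (ih 0 j k (l + 1) (by omega))
      have h6 := hle (N := n + (k + l)) (by omega) (h.mul_mem' (ih 0 j 0 1 (by omega)) hw)
      have h7 := hsym 0 j 0 1 (by omega) (by omega)
      have h9 : (j : F) • (f * leftMonomial F e f (0 + k) (j - 1 + l) -
          leftMonomial F e f (0 + k) (j - 1 + (l + 1))) ∈
          monomialFiltration F e f (n + 1 + (k + l) - 1) := by
        cases j with
        | zero => simp
        | succ j =>
          exact Submodule.smul_mem _ _ (hle (by omega) (h.right_mul_leftMonomial_sub_mem _ _))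
      have h10 := hle (N := n + (k + l)) (by omega)
        (h.associator_mem hb hy (m := k + l)
        (monomialFiltration_mono (by omega) (h.right_mul_leftMonomial_sub_mem k l)))
      -- The term `y·[L_b, L_f]w` becomes `2β(k - l)yw`; after halving it raises the coefficient `j`
      -- of the symbol to `j + 1`.
      rw [hβ, h.lie_leftMonomial] at h1
      have q1 := nat_smul_leftMonomial_right (F := F) (e := e) (f := f) j l (0 + k)
      convert add_mem (add_mem (add_mem (add_mem h2 h10) (Submodule.smul_mem _ (((k : F) - l) * β) h9))
        (Submodule.smul_mem _ (2 * β * ((k : F) - l)) h3))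
        (sub_mem (add_mem h4 h5) (add_mem h6 h7)) using 1
      have h8 := associator_add_add_associator_sub f (leftMonomial F e f 0 j) b
        (leftMonomial F e f k l)
      have h11 : associator (leftMonomial F e f 0 j) b (f * leftMonomial F e f k l -
          leftMonomial F e f k (l + 1)) = associator (leftMonomial F e f 0 j) b
          (f * leftMonomial F e f k l) - associator (leftMonomial F e f 0 j) b
          (leftMonomial F e f k (l + 1)) := by simp only [associator, mul_sub]; abel
      rw [leftMonomial_zero_one, show j + 1 - 1 + l = j + l by omega, h11]
      rw [right_mul_leftMonomial_zero e f j] at h1 h8 ⊢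
      generalize associator (leftMonomial F e f 0 (j + 1) - _) _ _ = a1 at h8 ⊢
      generalize associator (leftMonomial F e f 0 (j + 1) + _) _ _ = a2 at h1 h8
      simp only [mul_sub, sub_mul, mul_smul_comm, smul_mul_assoc, add_zero,
        show j - 1 + 1 + l = j - 1 + (l + 1) by omega, Nat.cast_zero, zero_smul, smul_zero,
        zero_add] at h1 h8 q1 ⊢
      linear_combination (norm := (push_cast; module)) h1 - h8 + (2 * ((k : F) - l) * β) • q1
    · have hy : leftMonomial F e f i j ∈ monomialFiltration F e f (n + 1) :=
        leftMonomial_mem (by omega)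
      have h1 := associator_jordan h.left_mem (h.commute hb (.inl rfl)) (leftMonomial F e f i j)
        (leftMonomial F e f k l)
      have h2 := hle (by omega) (h.associator_mem' hb (h.commutator_mem (.inl rfl) hy) hw)
      have h3 := hle (by omega) (h.leftMonomial_mul_sub_mem i j k l)
      have h4 := hle le_rfl (h.generator_mul_mem_pred (.inl rfl) (ih i j k l (by omega)))
      have h5 := hle (by omega) (ih i j (k + 1) l (by omega))
      have h6 := hle (N := n + (k + l)) (by omega) (h.mul_mem' (ih i j 1 0 (by omega)) hw)
      have h7 := hsym i j 1 0 (by omega) (by omega)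
      rw [hα, h.lie_leftMonomial] at h1
      have q1 := nat_smul_leftMonomial_left (F := F) (e := e) (f := f) i k (j + l)
      convert add_mem (add_mem h2 (Submodule.smul_mem _ (2 * α * ((k : F) - l)) h3))
        (sub_mem (add_mem h4 h5) (add_mem h6 h7)) using 1
      rw [leftMonomial_one_zero, ← left_mul_leftMonomial e f k l, show i + 1 - 1 + k = i + k by omega]
      have h8 := associator_add_add_associator_sub e (leftMonomial F e f i j) b
        (leftMonomial F e f k l)
      rw [left_mul_leftMonomial e f i j] at h1 h8 ⊢
      generalize associator (leftMonomial F e f (i + 1) j - _) _ _ = a1 at h8 ⊢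
      generalize associator (leftMonomial F e f (i + 1) j + _) _ _ = a2 at h1 h8
      simp only [mul_sub, mul_add, sub_mul, add_mul, mul_smul_comm, smul_mul_assoc,
        left_mul_leftMonomial, add_zero, show i - 1 + k + 1 = i - 1 + (k + 1) by omega,
        show i - 1 + 1 + k = i - 1 + (k + 1) by omega, show i + k + 1 = i + 1 + k by omega,
        show i + (k + 1) = i + 1 + k by omega] at h1 h8 ⊢
      linear_combination (norm := (push_cast; module)) h1 - h8 + (2 * ((k : F) - l) * α) • q1

end IsS2Pair

end Symbols

/-! ### Exact formulas for powers of `e`. -/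

section Powers

variable {F A : Type*} [Field F] [NonAssocRing A] [Module F A] [IsScalarTower F A A]
  [SMulCommClass F A A]

omit [IsScalarTower F A A] in
theorem naPow_eq_leftMonomial (e f : A) (n : ℕ) : naPow e n = leftMonomial F e f n 0 := by
  induction n with
  | zero => rfl
  | succ n ih => rw [naPow, ih, left_mul_leftMonomial]

namespace IsS2Pair

variable {e f : A} (h : IsS2Pair F e f)
include h

theorem f_mul_leftMonomial (i j : ℕ) :
    f * leftMonomial F e f i j = leftMonomial F e f i (j + 1) -
      ((i : F) * (i - 1 - 2 * j)) • leftMonomial F e f (i - 1) j := by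
  cases i with
  | zero => simp [right_mul_leftMonomial_zero]
  | succ i =>
    rw [h.right_mul_leftMonomial_succ, Nat.add_sub_cancel]
    push_cast
    module

variable [CharZero F]

omit [IsScalarTower F A A] in
-- No lower terms occur, because `L_{e^n} = L_e^n`: inductively `e^n e = e^{n+1}`, so `e∘e^n =
-- 2e^{n+1}`, and the Jordan rule applies.
theorem leftMonomial_zero_mul_leftMonomial (n i j : ℕ) :
    leftMonomial F e f n 0 * leftMonomial F e f i j = leftMonomial F e f (n + i) j := by
  induction n generalizing i j with
  | zero => simp [orderedMonomial]
  | succ n ih =>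
    have h1 := mul_add_mul_mul_of_mem_leftAltNucleus h.left_mem (leftMonomial F e f n 0)
      (leftMonomial F e f i j)
    have h2 := ih 1 0
    rw [leftMonomial_one_zero] at h2
    rw [h2, left_mul_leftMonomial, left_mul_leftMonomial, ih, ih, left_mul_leftMonomial,
      show n + (i + 1) = n + i + 1 by omega] at h1
    rw [show n + 1 + i = n + i + 1 by omega]
    refine smul_right_injective A (two_ne_zero (α := F)) ?_
    dsimp only
    linear_combination (norm := module) h1

/-- The Jordan rule for `f∘e^n`, with `e^n·f` the ordered monomial and `f·e^n` put in normal order.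
-/
theorem two_smul_leftMonomial_one_mul (n : ℕ) (x : A) :
    (2 : F) • (leftMonomial F e f n 1 * x) =
      f * (leftMonomial F e f n 0 * x) + leftMonomial F e f n 0 * (f * x) +
        ((n : F) * (n - 1)) • (leftMonomial F e f (n - 1) 0 * x) := by
  have h1 := mul_add_mul_mul_of_mem_leftAltNucleus h.right_mem (leftMonomial F e f n 0) x
  have h2 := h.leftMonomial_zero_mul_leftMonomial n 0 1
  rw [leftMonomial_zero_one] at h2
  rw [h2, h.f_mul_leftMonomial, sub_mul, smul_mul_assoc] at h1
  linear_combination (norm := (push_cast; module)) h1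

theorem leftMonomial_one_mul_left (n : ℕ) :
    leftMonomial F e f n 1 * e = leftMonomial F e f (n + 1) 1 - (n : F) • leftMonomial F e f n 0 := by
  have h1 := h.two_smul_leftMonomial_one_mul n (leftMonomial F e f 1 0)
  have h2 : ((n : F) * (n - 1)) • leftMonomial F e f (n - 1 + 1) 0 =
      ((n : F) * (n - 1)) • leftMonomial F e f n 0 := by
    cases n with
    | zero => simp
    | succ n => rfl
  have h3 := h.leftMonomial_zero_mul_leftMonomial n 1 1
  rw [← left_mul_leftMonomial, leftMonomial_zero_one, h.comm] at h3
  rw [h.leftMonomial_zero_mul_leftMonomial, h.leftMonomial_zero_mul_leftMonomial, h2,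
    h.f_mul_leftMonomial, leftMonomial_one_zero, h3] at h1
  refine smul_right_injective A (two_ne_zero (α := F)) ?_
  simp only [Nat.add_sub_cancel] at *
  linear_combination (norm := (push_cast; module)) h1

theorem associator_leftMonomial_right_right (n : ℕ) :
    associator (leftMonomial F e f n 0) f f = (n : F) • leftMonomial F e f (n - 1) 1 := by
  have h1 := h.two_smul_leftMonomial_one_mul n (leftMonomial F e f 0 1)
  have h2 := h.leftMonomial_zero_mul_leftMonomial n 0 1
  have h3 := h.leftMonomial_zero_mul_leftMonomial n 0 2
  rw [← right_mul_leftMonomial_zero, leftMonomial_zero_one, add_zero] at h3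
  rw [h.leftMonomial_zero_mul_leftMonomial, h.leftMonomial_zero_mul_leftMonomial,
    h.f_mul_leftMonomial, leftMonomial_zero_one, h3] at h1
  rw [leftMonomial_zero_one] at h2
  refine smul_right_injective A (two_ne_zero (α := F)) ?_
  rw [associator, h2, h3]
  simp only [add_zero] at *
  linear_combination (norm := (push_cast; module)) h1

theorem associator_leftMonomial_right_left (n : ℕ) :
    associator (leftMonomial F e f n 0) f e = -(n : F) • leftMonomial F e f n 0 := by
  have h1 := h.leftMonomial_zero_mul_leftMonomial n 1 1
  have h2 := h.leftMonomial_zero_mul_leftMonomial n 0 1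
  rw [← left_mul_leftMonomial, leftMonomial_zero_one, h.comm] at h1
  rw [leftMonomial_zero_one, add_zero] at h2
  rw [associator, h2, h1, h.leftMonomial_one_mul_left]
  module

/-- Combine `(e^n,f,f) = n e^{n-1}f` with `(e^{n-1}f)e = e^n f - (n-1)e^{n-1}`. -/
theorem associator_naPow_mul (n : ℕ) : associator (naPow e n) f f * e =
    (n : F) • (naPow e n * f) - ((n : F) * ((n : F) - 1)) • naPow e (n - 1) := by
  have h2 := h.leftMonomial_zero_mul_leftMonomial n 0 1
  rw [leftMonomial_zero_one, add_zero] at h2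
  rw [naPow_eq_leftMonomial (F := F) e f, naPow_eq_leftMonomial (F := F) e f, h2,
    h.associator_leftMonomial_right_right, smul_mul_assoc, h.leftMonomial_one_mul_left]
  cases n with
  | zero => simp
  | succ n =>
    rw [Nat.add_sub_cancel]
    push_cast
    module

end IsS2Pair

end Powers

/-! ### Triangular endomorphisms of a graded space. -/

section TriangularMap

variable {F : Type*} [Field F]

variable (F) in
/-- The functions on `ℕ × ℕ` supported in degree less than `n`. -/
abbrev supportedBelow (n : ℕ) : Submodule F (ℕ × ℕ →₀ F) :=
  Finsupp.supported F F {p | p.1 + p.2 < n}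

theorem single_mem_supportedBelow {p : ℕ × ℕ} {n : ℕ} (h : p.1 + p.2 < n) (r : F) :
    Finsupp.single p r ∈ supportedBelow F n :=
  Finsupp.single_mem_supported F r h

theorem supportedBelow_mono {m n : ℕ} (h : m ≤ n) : supportedBelow F m ≤ supportedBelow F n :=
  Finsupp.supported_mono fun _ hp => lt_of_lt_of_le hp h

theorem exists_mem_supportedBelow (x : ℕ × ℕ →₀ F) : ∃ n, x ∈ supportedBelow F n :=
  ⟨x.support.sup (fun p => p.1 + p.2) + 1, fun _ hp =>
    Nat.lt_succ_of_le (Finset.le_sup (f := fun p : ℕ × ℕ => p.1 + p.2) hp)⟩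

theorem apply_eq_zero_of_mem_supportedBelow {x : ℕ × ℕ →₀ F} {n : ℕ} (hx : x ∈ supportedBelow F n)
    {p : ℕ × ℕ} (hp : n ≤ p.1 + p.2) : x p = 0 := by
  by_contra h0
  have : p.1 + p.2 < n := hx (Finsupp.mem_support_iff.2 h0)
  omega

theorem mem_supportedBelow_of_succ {x : ℕ × ℕ →₀ F} {n : ℕ} (hx : x ∈ supportedBelow F (n + 1))
    (h : ∀ p : ℕ × ℕ, p.1 + p.2 = n → x p = 0) : x ∈ supportedBelow F n := by
  intro p hp
  have h1 : p.1 + p.2 < n + 1 := hx hp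
  have h2 : p.1 + p.2 ≠ n := fun h2 => Finsupp.mem_support_iff.1 hp (h p h2)
  change p.1 + p.2 < n
  omega

theorem eq_zero_of_mem_supportedBelow_zero {x : ℕ × ℕ →₀ F} (hx : x ∈ supportedBelow F 0) :
    x = 0 :=
  Finsupp.ext fun _ => apply_eq_zero_of_mem_supportedBelow hx (Nat.zero_le _)

theorem supportedBelow_induction {M : Type*} [AddCommGroup M] [Module F M] {n : ℕ}
    {S : Submodule F M} (φ : (ℕ × ℕ →₀ F) →ₗ[F] M)
    (h : ∀ i j, i + j < n → φ (Finsupp.single (i, j) 1) ∈ S) {x : ℕ × ℕ →₀ F}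
    (hx : x ∈ supportedBelow F n) : φ x ∈ S := by
  have : supportedBelow F n ≤ S.comap φ := by
    rw [supportedBelow, Finsupp.supported_eq_span_single]
    refine Submodule.span_le.2 ?_
    rintro _ ⟨⟨i, j⟩, hij, rfl⟩
    exact h i j hij
  exact this hx

/-- A linear map that is triangular for the degree with invertible diagonal is bijective. -/
theorem bijective_of_triangular (φ : Module.End F (ℕ × ℕ →₀ F)) (c : ℕ → ℕ → F)
    (hc : ∀ i j, c i j ≠ 0)
    (h : ∀ i j, φ (Finsupp.single (i, j) 1) - c i j • Finsupp.single (i, j) 1 ∈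
      supportedBelow F (i + j)) : Function.Bijective φ := by
  -- On the top degree `φ` acts diagonally, which gives injectivity by descent on the degree.
  have htop : ∀ n, ∀ x ∈ supportedBelow F (n + 1), ∀ p : ℕ × ℕ, p.1 + p.2 = n →
      φ x p = c p.1 p.2 * x p := by
    intro n x hx p hp
    have := supportedBelow_induction (S := ⊥)
      ((Finsupp.lapply p).comp φ - c p.1 p.2 • Finsupp.lapply p) (fun i j hij => ?_) hx
    · simpa [sub_eq_zero] using this
    have h1 := apply_eq_zero_of_mem_supportedBelow (h i j) (p := p) (by omega)
    rw [Submodule.mem_bot]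
    by_cases hpij : (i, j) = p
    · subst hpij
      simpa using h1
    · simpa [Finsupp.single_apply, hpij] using h1
  constructor
  · refine (injective_iff_map_eq_zero φ).2 fun x hx => ?_
    obtain ⟨n, hn⟩ := exists_mem_supportedBelow x
    induction n with
    | zero => exact eq_zero_of_mem_supportedBelow_zero hn
    | succ n ih =>
      refine ih (mem_supportedBelow_of_succ hn fun p hp => ?_)
      have := htop n x hn p hp
      rw [hx, Finsupp.zero_apply, eq_comm, mul_eq_zero] at this
      exact this.resolve_left (hc _ _)
  · have hle : ∀ n, supportedBelow F n ≤ LinearMap.range φ := by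
      intro n
      induction n with
      | zero =>
        intro x hx
        rw [eq_zero_of_mem_supportedBelow_zero hx]
        exact zero_mem _
      | succ n ih =>
        refine fun x hx => supportedBelow_induction LinearMap.id (fun i j hij => ?_) hx
        have h1 := ih (supportedBelow_mono (by omega) (h i j))
        have h2 := sub_mem (LinearMap.mem_range_self φ (Finsupp.single (i, j) 1)) h1
        rw [sub_sub_cancel] at h2
        exact (Submodule.smul_mem_iff _ (hc i j)).1 h2
    intro x
    obtain ⟨n, hn⟩ := exists_mem_supportedBelow x
    exact hle n hn

end TriangularMap

/-- The bracket of the two anticommutator operators is the commutator with `[E, D]`, which kills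
`1`; a further bracket turns it back into an anticommutator, so the `sl₂` relations persist. -/
theorem isSphericalVector_mulLeft_add_mulRight {F B : Type*} [Field F] [Ring B] [Algebra F B]
    {E D : B} (he : (E * D - D * E) * E - E * (E * D - D * E) = (2 : F) • E)
    (hf : (E * D - D * E) * D - D * (E * D - D * E) = (-2 : F) • D) :
    IsSphericalVector (LinearMap.mulLeft F E + LinearMap.mulRight F E)
      (LinearMap.mulLeft F D + LinearMap.mulRight F D) 1 where
  lie_e := LinearMap.ext fun x => by
    have h1 : (2 : F) • (E * x + x * E) = ((E * D - D * E) * E - E * (E * D - D * E)) * x +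
        x * ((E * D - D * E) * E - E * (E * D - D * E)) := by
      rw [he, smul_mul_assoc, mul_smul_comm, smul_add]
    simp only [LinearMap.sub_apply, Module.End.mul_apply, LinearMap.smul_apply,
      LinearMap.add_apply, LinearMap.mulLeft_apply, LinearMap.mulRight_apply]
    rw [h1]
    noncomm_ring
  lie_f := LinearMap.ext fun x => by
    have h1 : (-2 : F) • (D * x + x * D) = ((E * D - D * E) * D - D * (E * D - D * E)) * x +
        x * ((E * D - D * E) * D - D * (E * D - D * E)) := by
      rw [hf, smul_mul_assoc, mul_smul_comm, smul_add]
    rw [LinearMap.smul_apply]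
    simp only [LinearMap.sub_apply, Module.End.mul_apply,
      LinearMap.add_apply, LinearMap.mulLeft_apply, LinearMap.mulRight_apply]
    rw [h1]
    noncomm_ring
  lie_apply := by
    simp only [LinearMap.add_apply, LinearMap.mulLeft_apply, LinearMap.mulRight_apply]
    noncomm_ring

/-! ### A concrete model of `U(S₂)` with the monomial basis. -/

noncomputable section Model

/-- The space underlying a concrete model of `U(S₂)`: it has a basis indexed by `ℕ × ℕ`. -/
def S2Model (F : Type*) [Field F] : Type _ := ℕ × ℕ →₀ F

namespace S2Model

variable {F : Type*} [Field F]

instance : AddCommGroup (S2Model F) := inferInstanceAs (AddCommGroup (ℕ × ℕ →₀ F))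

instance : Module F (S2Model F) := inferInstanceAs (Module F (ℕ × ℕ →₀ F))

variable (F) in
/-- The basis vectors. -/
def vec (i j : ℕ) : S2Model F := Finsupp.single (i, j) 1

variable (F) in
/-- The basis of the model. -/
def basis : Module.Basis (ℕ × ℕ) F (S2Model F) := Finsupp.basisSingleOne

theorem basis_apply (p : ℕ × ℕ) : basis F p = vec F p.1 p.2 :=
  congrFun (Finsupp.coe_basisSingleOne (R := F) (ι := ℕ × ℕ)) p

variable (F) in
/-- The span of the basis vectors of degree less than `n`. -/
def below (n : ℕ) : Submodule F (S2Model F) := supportedBelow F n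

theorem vec_mem_below {i j n : ℕ} (h : i + j < n) : vec F i j ∈ below F n :=
  single_mem_supportedBelow (p := (i, j)) h 1

theorem below_mono {m n : ℕ} (h : m ≤ n) : below F m ≤ below F n :=
  supportedBelow_mono h

theorem below_induction {n : ℕ} {S : Submodule F (S2Model F)} (φ : Module.End F (S2Model F))
    (h : ∀ i j, i + j < n → φ (vec F i j) ∈ S) {x : S2Model F} (hx : x ∈ below F n) : φ x ∈ S :=
  supportedBelow_induction φ h hx

theorem linearMap_ext {M : Type*} [AddCommGroup M] [Module F M] {g g' : S2Model F →ₗ[F] M}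
    (h : ∀ i j, g (vec F i j) = g' (vec F i j)) : g = g' :=
  (basis F).ext fun p => by rw [basis_apply, h]

variable (F) in
/-- The operator of left multiplication by `e`. -/
def opE : Module.End F (S2Model F) :=
  (basis F).constr F fun p => vec F (p.1 + 1) p.2

variable (F) in
/-- The operator of left multiplication by `f`. -/
def opF : Module.End F (S2Model F) :=
  (basis F).constr F fun p => vec F p.1 (p.2 + 1) -
    ((p.1 : F) * (p.1 - 1 - 2 * p.2)) • vec F (p.1 - 1) p.2

theorem opE_vec (i j : ℕ) : opE F (vec F i j) = vec F (i + 1) j := by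
  have := (basis F).constr_basis F (fun p => vec F (p.1 + 1) p.2) (i, j)
  rwa [basis_apply] at this

theorem opF_vec (i j : ℕ) : opF F (vec F i j) = vec F i (j + 1) -
    ((i : F) * (i - 1 - 2 * j)) • vec F (i - 1) j := by
  have := (basis F).constr_basis F (fun p => vec F p.1 (p.2 + 1) -
    ((p.1 : F) * (p.1 - 1 - 2 * p.2)) • vec F (p.1 - 1) p.2) (i, j)
  rwa [basis_apply] at this

theorem lie_vec (i j : ℕ) :
    opE F (opF F (vec F i j)) - opF F (opE F (vec F i j)) = (2 * ((i : F) - j)) • vec F i j := by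
  rw [opE_vec, opF_vec, opF_vec, map_sub, map_smul, opE_vec, opE_vec, Nat.add_sub_cancel]
  cases i with
  | zero => push_cast; module
  | succ i => rw [Nat.add_sub_cancel]; push_cast; module

theorem isSphericalVector : IsSphericalVector (opE F) (opF F) (vec F 0 0) where
  lie_e := linearMap_ext fun i j => by
    simp only [LinearMap.sub_apply, Module.End.mul_apply, LinearMap.smul_apply]
    rw [lie_vec, map_smul, opE_vec, lie_vec]
    push_cast; module
  lie_f := linearMap_ext fun i j => by
    rw [LinearMap.smul_apply]
    simp only [LinearMap.sub_apply, Module.End.mul_apply]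
    rw [lie_vec, map_smul, opF_vec, map_sub, map_sub, map_sub, map_sub, map_smul, map_smul,
      map_smul, map_smul]
    have h1 := lie_vec (F := F) i (j + 1)
    have h2 := lie_vec (F := F) (i - 1) j
    cases i with
    | zero => linear_combination (norm := (push_cast; module)) h1
    | succ i =>
      rw [Nat.add_sub_cancel] at *
      linear_combination (norm := (push_cast; module)) h1 -
        (((i + 1 : ℕ) : F) * (((i + 1 : ℕ) : F) - 1 - 2 * j)) • h2
  lie_apply := by rw [opE_vec, opF_vec, opF_vec]; simp [opE_vec]

variable (F) in
/-- The linear map to operators with `x ↦ E ρ(x) + ρ(x) E` for the action of `E` and likewise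
for `F`. -/
def rho : S2Model F →ₗ[F] Module.End F (S2Model F) :=
  (basis F).constr F fun p => orderedMonomial
    (LinearMap.mulLeft F (opE F) + LinearMap.mulRight F (opE F))
    (LinearMap.mulLeft F (opF F) + LinearMap.mulRight F (opF F)) 1 p.1 p.2

theorem rho_vec (i j : ℕ) : rho F (vec F i j) = orderedMonomial
    (LinearMap.mulLeft F (opE F) + LinearMap.mulRight F (opE F))
    (LinearMap.mulLeft F (opF F) + LinearMap.mulRight F (opF F)) 1 i j := by
  have := (basis F).constr_basis F (fun p => orderedMonomial
    (LinearMap.mulLeft F (opE F) + LinearMap.mulRight F (opE F))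
    (LinearMap.mulLeft F (opF F) + LinearMap.mulRight F (opF F)) 1 p.1 p.2) (i, j)
  rwa [basis_apply] at this

theorem rho_opE (x : S2Model F) : rho F (opE F x) = opE F * rho F x + rho F x * opE F := by
  have : rho F ∘ₗ opE F =
      (LinearMap.mulLeft F (opE F) + LinearMap.mulRight F (opE F)) ∘ₗ rho F :=
    linearMap_ext fun i j => by
      rw [LinearMap.comp_apply, LinearMap.comp_apply, opE_vec, rho_vec, rho_vec,
        IsSphericalVector.apply_e_orderedMonomial]
  exact LinearMap.congr_fun this x

/-- The anticommutator operators again have a spherical vector, so their ordered monomials obey the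
same straightening rule that defines `opF`. -/
theorem rho_opF (x : S2Model F) : rho F (opF F x) = opF F * rho F x + rho F x * opF F := by
  have hs := isSphericalVector_mulLeft_add_mulRight (isSphericalVector (F := F)).lie_e
    (isSphericalVector (F := F)).lie_f
  have : rho F ∘ₗ opF F =
      (LinearMap.mulLeft F (opF F) + LinearMap.mulRight F (opF F)) ∘ₗ rho F :=
    linearMap_ext fun i j => by
      rw [LinearMap.comp_apply, LinearMap.comp_apply, opF_vec, map_sub, map_smul, rho_vec, rho_vec,
        rho_vec]
      cases i with
      | zero => rw [IsSphericalVector.apply_f_orderedMonomial_zero]; simp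
      | succ i =>
        rw [hs.apply_f_orderedMonomial_succ, Nat.add_sub_cancel]
        push_cast; module
  exact LinearMap.congr_fun this x

variable (F) in
/-- The symmetrization map `x ↦ ρ(x) 1`. -/
def symm₀ : Module.End F (S2Model F) := (rho F).flip (vec F 0 0)

theorem rho_vec_zero : rho F (vec F 0 0) = 1 := rho_vec 0 0

theorem opE_mem {n : ℕ} {x : S2Model F} (hx : x ∈ below F n) :
    opE F x ∈ below F (n + 1) :=
  below_induction (opE F) (fun i j hij => by
    rw [opE_vec]
    exact vec_mem_below (by omega)) hx

theorem opF_vec_sub_mem (i j : ℕ) :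
    opF F (vec F i j) - vec F i (j + 1) ∈ below F (i + j) := by
  rw [opF_vec]
  cases i with
  | zero => simp
  | succ i =>
    rw [sub_sub_cancel_left]
    exact neg_mem (Submodule.smul_mem _ _
      (vec_mem_below (by omega)))

theorem opF_mem {n : ℕ} {x : S2Model F} (hx : x ∈ below F n) :
    opF F x ∈ below F (n + 1) :=
  below_induction (opF F) (fun i j hij => by
    rw [← sub_add_cancel (opF F _) (vec F i (j + 1))]
    exact add_mem (below_mono (by omega) (opF_vec_sub_mem i j))
      (vec_mem_below (by omega))) hx

theorem rho_opE_apply (x y : S2Model F) :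
    rho F (opE F x) y = opE F (rho F x y) + rho F x (opE F y) := by
  rw [rho_opE]; rfl

theorem rho_opF_apply (x y : S2Model F) :
    rho F (opF F x) y = opF F (rho F x y) + rho F x (opF F y) := by
  rw [rho_opF]; rfl

theorem vec_zero_succ (j : ℕ) : vec F 0 (j + 1) = opF F (vec F 0 j) := by
  rw [opF_vec]; simp

theorem rho_vec_mem (i j : ℕ) {n : ℕ} {y : S2Model F} (hy : y ∈ below F n) :
    rho F (vec F i j) y ∈ below F (i + j + n) := by
  induction i generalizing n y with
  | zero =>
    induction j generalizing n y with
    | zero => rw [rho_vec_zero]; simpa using hy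
    | succ j ih =>
      rw [vec_zero_succ, rho_opF_apply]
      exact add_mem (below_mono (by omega) (opF_mem (ih hy)))
        (below_mono (by omega) (ih (opF_mem hy)))
  | succ i ih =>
    rw [← opE_vec, rho_opE_apply]
    exact add_mem (below_mono (by omega) (opE_mem (ih hy)))
        (below_mono (by omega) (ih (opE_mem hy)))

/-- Each of the `i + j` anticommutators doubles the leading monomial, whence the factor `2^(i+j)`.
-/
theorem rho_vec_sub_mem (i j k l : ℕ) :
    rho F (vec F i j) (vec F k l) - (2 : F) ^ (i + j) • vec F (i + k) (j + l) ∈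
      below F (i + j + k + l) := by
  induction i generalizing k l with
  | zero =>
    induction j generalizing k l with
    | zero => rw [rho_vec_zero]; simp
    | succ j ih =>
      have h1 := opF_mem (ih k l)
      have h2 := ih k (l + 1)
      have h3 := rho_vec_mem 0 j (opF_vec_sub_mem (F := F) k l)
      have h4 := Submodule.smul_mem _ ((2 : F) ^ (0 + j)) (opF_vec_sub_mem (F := F) (0 + k) (j + l))
      replace h1 := below_mono (n := 0 + (j + 1) + k + l) (by omega) h1
      replace h2 := below_mono (n := 0 + (j + 1) + k + l) (by omega) h2
      replace h3 := below_mono (n := 0 + (j + 1) + k + l) (by omega) h3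
      replace h4 := below_mono (n := 0 + (j + 1) + k + l) (by omega) h4
      convert add_mem (add_mem h1 h2) (add_mem h3 h4) using 1
      rw [vec_zero_succ, rho_opF_apply, map_sub, map_sub, map_smul,
        show j + 1 + l = j + l + 1 by omega, show j + (l + 1) = j + l + 1 by omega,
        ← add_assoc 0 j 1, pow_succ]
      module
  | succ i ih =>
    have h1 := opE_mem (ih k l)
    have h2 := ih (k + 1) l
    replace h1 := below_mono (n := i + 1 + j + k + l) (by omega) h1
    replace h2 := below_mono (n := i + 1 + j + k + l) (by omega) h2
    convert add_mem h1 h2 using 1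
    rw [← opE_vec i, rho_opE_apply, map_sub, map_smul, opE_vec, opE_vec,
      show i + 1 + k = i + k + 1 by omega, show i + (k + 1) = i + k + 1 by omega,
      show i + 1 + j = i + j + 1 by omega, pow_succ]
    module

variable [CharZero F]

theorem symm₀_bijective : Function.Bijective (symm₀ F) :=
  bijective_of_triangular (symm₀ F) (fun i j => 2 ^ (i + j))
    (fun _ _ => pow_ne_zero _ two_ne_zero) fun i j => rho_vec_sub_mem (F := F) i j 0 0

variable (F) in
/-- The symmetrization map as an equivalence. -/
def symmEquiv : S2Model F ≃ₗ[F] S2Model F := LinearEquiv.ofBijective (symm₀ F) symm₀_bijective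

theorem symmEquiv_apply (x : S2Model F) : symmEquiv F x = rho F x (vec F 0 0) := rfl

variable (F) in
/-- The operators of left multiplication in the model. -/
def leftMul : S2Model F →ₗ[F] Module.End F (S2Model F) := rho F ∘ₗ (symmEquiv F).symm

theorem leftMul_symmEquiv (x : S2Model F) : leftMul F (symmEquiv F x) = rho F x := by
  rw [leftMul, LinearMap.comp_apply, LinearEquiv.coe_coe, LinearEquiv.symm_apply_apply]

theorem leftMul_vec_zero : leftMul F (vec F 0 0) = 1 := by
  have := leftMul_symmEquiv (vec F 0 0)
  rw [symmEquiv_apply, rho_vec_zero] at this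
  exact this

theorem leftMul_apply_vec_zero (x : S2Model F) : leftMul F x (vec F 0 0) = x := by
  obtain ⟨x, rfl⟩ := (symmEquiv F).surjective x
  rw [leftMul_symmEquiv, symmEquiv_apply]

/-- Both `ρ` and the symmetrization double here: `ρ(e) = 2E` and the symmetrization of `e` is `2e`.
-/
theorem leftMul_vec_one_zero : leftMul F (vec F 1 0) = opE F := by
  have := leftMul_symmEquiv (vec F 1 0)
  rw [symmEquiv_apply, ← opE_vec, rho_opE, rho_vec_zero, mul_one, one_mul, LinearMap.add_apply,
    map_add] at this
  refine smul_right_injective _ (two_ne_zero (α := F)) ?_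
  dsimp only
  rw [two_smul, two_smul, ← this, opE_vec]

theorem leftMul_vec_zero_one : leftMul F (vec F 0 1) = opF F := by
  have := leftMul_symmEquiv (vec F 0 1)
  rw [symmEquiv_apply, vec_zero_succ, rho_opF, rho_vec_zero, mul_one, one_mul,
    LinearMap.add_apply, map_add] at this
  refine smul_right_injective _ (two_ne_zero (α := F)) ?_
  dsimp only
  rw [two_smul, two_smul, ← this, vec_zero_succ]

instance : NonAssocRing (S2Model F) where
  mul x y := leftMul F x y
  one := vec F 0 0
  left_distrib x y z := map_add (leftMul F x) y z
  right_distrib x y z := LinearMap.congr_fun (map_add (leftMul F) x y) z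
  zero_mul x := LinearMap.congr_fun (map_zero (leftMul F)) x
  mul_zero x := map_zero (leftMul F x)
  one_mul x := LinearMap.congr_fun leftMul_vec_zero x
  mul_one x := leftMul_apply_vec_zero x

theorem mul_def (x y : S2Model F) : x * y = leftMul F x y := rfl

instance : IsScalarTower F (S2Model F) (S2Model F) :=
  ⟨fun r x y => LinearMap.congr_fun (map_smul (leftMul F) r x) y⟩

instance : SMulCommClass F (S2Model F) (S2Model F) :=
  ⟨fun r x y => (map_smul (leftMul F x) r y).symm⟩

variable (F) in
/-- The embedding of `S₂` in the model. -/
def incl : S2 F →ₗ[F] S2Model F where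
  toFun x := x.1 • vec F 1 0 + x.2 • vec F 0 1
  map_add' x y := by rw [S2.add_fst, S2.add_snd]; module
  map_smul' r x := by rw [S2.smul_fst, S2.smul_snd, RingHom.id_apply]; module

theorem incl_apply (x : S2 F) : incl F x = x.1 • vec F 1 0 + x.2 • vec F 0 1 := rfl

theorem incl_mul (x : S2 F) (y : S2Model F) :
    incl F x * y = x.1 • opE F y + x.2 • opF F y := by
  rw [incl_apply, mul_def, map_add, map_smul, map_smul, leftMul_vec_one_zero,
    leftMul_vec_zero_one]
  rfl

/-- If `x` is the symmetrization of `u`, then `a∘x` is the symmetrization of `a` acting on `u`, and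
`ρ` turns that action into an anticommutator. -/
theorem leftMul_jordan (a : S2 F) (x y : S2Model F) :
    (incl F a * x + x * incl F a) * y = incl F a * (x * y) + x * (incl F a * y) := by
  obtain ⟨u, rfl⟩ := (symmEquiv F).surjective x
  have h1 : incl F a * symmEquiv F u + symmEquiv F u * incl F a =
      symmEquiv F (a.1 • opE F u + a.2 • opF F u) := by
    rw [incl_mul, mul_def, leftMul_symmEquiv, symmEquiv_apply, symmEquiv_apply, incl_apply,
      map_add, map_add, map_smul, map_smul, map_smul, map_smul, LinearMap.add_apply,
      LinearMap.smul_apply, LinearMap.smul_apply, rho_opE_apply, rho_opF_apply, opE_vec,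
      ← vec_zero_succ]
    module
  rw [h1, mul_def, mul_def (symmEquiv F u), mul_def (symmEquiv F u), leftMul_symmEquiv,
    leftMul_symmEquiv, incl_mul, incl_mul, map_add, map_add, map_smul, map_smul, map_smul, map_smul,
    LinearMap.add_apply, LinearMap.smul_apply, LinearMap.smul_apply, rho_opE_apply, rho_opF_apply]
  module

theorem isSpecialMap_incl : IsSpecialMap (incl F) where
  mem_leftAltNucleus a x y := by
    have := leftMul_jordan a x y
    rw [add_mul] at this
    simp only [associator]
    linear_combination (norm := module) this
  map_bracket a b c := by
    change incl F (S2.triple a b c) = _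
    rw [tripleProduct]
    simp only [incl_mul]
    simp only [incl_apply, map_add, map_sub, map_smul, opE_vec, opF_vec, S2.triple_fst, S2.triple_snd]
    simp
    module
  comm a b := by
    rw [incl_mul, incl_mul, incl_apply, incl_apply]
    simp only [map_add, map_smul, opE_vec, opF_vec]
    simp
    module

end S2Model

end Model

/-! ### Right ideals and elements of least degree. -/

theorem IsRightIdeal.associator_mem {F A : Type*} [Field F] [NonAssocRing A] [Module F A]
    {I : Submodule F A} (hI : IsRightIdeal I) {x : A} (hx : x ∈ I) (y z : A) :
    associator x y z ∈ I :=
  sub_mem (hI _ (hI x hx y) z) (hI x hx _)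

section RightIdeals

variable {F A : Type*} [Field F] [NonAssocRing A] [Module F A] [IsScalarTower F A A]
  [SMulCommClass F A A]

variable (F) in
/-- The linear map `x ↦ (x, b, w)`. -/
def associatorLinear (b w : A) : Module.End F A :=
  LinearMap.mulRight F w * LinearMap.mulRight F b - LinearMap.mulRight F (b * w)

omit [SMulCommClass F A A] in
theorem associatorLinear_apply (b w x : A) : associatorLinear F b w x = associator x b w := rfl

omit [IsScalarTower F A A] in
theorem repr_apply_eq_of_mem {e f : A} {B : Module.Basis (ℕ × ℕ) F A} {n : ℕ}
    {p : ℕ × ℕ} (T : Module.End F A) (g : A →ₗ[F] F)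
    (hT : ∀ i j, i + j ≤ n → B.repr (T (leftMonomial F e f i j)) p = g (leftMonomial F e f i j))
    {x : A} (hx : x ∈ monomialFiltration F e f (n + 1)) : B.repr (T x) p = g x := by
  have : Set.EqOn (B.coord p ∘ₗ T) g
      {x | ∃ i j, i + j < n + 1 ∧ leftMonomial F e f i j = x} := by
    rintro _ ⟨i, j, hij, rfl⟩
    exact hT i j (by omega)
  exact LinearMap.eqOn_span this hx

omit [IsScalarTower F A A] in
theorem left_mem_monomialFiltration {e f : A} : e ∈ monomialFiltration F e f (1 + 1) := by
  have := leftMonomial_mem (F := F) (e := e) (f := f) (i := 1) (j := 0) (n := 2) (by omega)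
  rwa [leftMonomial_one_zero] at this

section Coordinates

variable {e f : A} {B : Module.Basis (ℕ × ℕ) F A} (hB : ∀ i j, B (i, j) = leftMonomial F e f i j)
include hB

omit [IsScalarTower F A A] in
theorem repr_leftMonomial (i j : ℕ) :
    B.repr (leftMonomial F e f i j) = Finsupp.single (i, j) 1 := by
  rw [← hB, B.repr_self]

omit [IsScalarTower F A A] in
theorem mem_monomialFiltration_iff {n : ℕ} {x : A} :
    x ∈ monomialFiltration F e f n ↔ B.repr x ∈ supportedBelow F n := by
  constructor
  · intro hx
    have : monomialFiltration F e f n ≤ (supportedBelow F n).comap B.repr.toLinearMap := by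
      refine Submodule.span_le.2 ?_
      rintro _ ⟨i, j, hij, rfl⟩
      change B.repr _ ∈ supportedBelow F n
      rw [repr_leftMonomial hB]
      exact single_mem_supportedBelow (p := (i, j)) hij 1
    exact this hx
  · intro hx
    have := supportedBelow_induction (S := monomialFiltration F e f n) B.repr.symm.toLinearMap
      (fun i j hij => ?_) hx
    · simpa using this
    · rw [← repr_leftMonomial hB]
      simpa using leftMonomial_mem hij

omit [IsScalarTower F A A] in
theorem mem_monomialFiltration_of_succ {n : ℕ} {x : A} (hx : x ∈ monomialFiltration F e f (n + 1))
    (hp : ∀ i j, i + j = n → B.repr x (i, j) = 0) : x ∈ monomialFiltration F e f n := by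
  rw [mem_monomialFiltration_iff hB] at *
  exact mem_supportedBelow_of_succ hx fun p h => hp p.1 p.2 h

omit [IsScalarTower F A A] in
theorem repr_eq_zero_of_mem {n i j : ℕ} {x : A} (hx : x ∈ monomialFiltration F e f n)
    (hij : n ≤ i + j) : B.repr x (i, j) = 0 :=
  apply_eq_zero_of_mem_supportedBelow ((mem_monomialFiltration_iff hB).1 hx) hij

end Coordinates

namespace IsS2Pair

variable {e f : A} (h : IsS2Pair F e f) [CharZero F]
include h

/-- The leading part is the vector field `e ∂_f`: here `[e,e] = 0` gives `α = 0`, `β = 1`, and `w =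
e` gives `k - l = 1`. -/
theorem associator_leftMonomial_left_sub_mem (i j : ℕ) :
    associator (leftMonomial F e f i j) e e - (j : F) • leftMonomial F e f (i + 1) (j - 1) ∈
      monomialFiltration F e f (i + j) := by
  have := h.associator_leftMonomial_sub_mem (.inl rfl) (α := 0) (β := 1) (fun x => by simp)
    (fun x => by simp) i j 1 0
  rw [leftMonomial_one_zero] at this
  simpa using this

/-- The leading part is `-e ∂_e`, diagonal on monomials: now `[f,e] = -[e,f]` gives `α = -1`, `β =
0`. -/
theorem associator_leftMonomial_right_left_add_mem (i j : ℕ) :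
    associator (leftMonomial F e f i j) f e + (i : F) • leftMonomial F e f i j ∈
      monomialFiltration F e f (i + j) := by
  have h1 := h.associator_leftMonomial_sub_mem (.inr rfl) (α := -1) (β := 0) (fun x => by simp)
    (fun x => by simp) i j 1 0
  have h2 := nat_smul_leftMonomial_left (F := F) (e := e) (f := f) i 0 j
  rw [leftMonomial_one_zero] at h1
  simp only [zero_add, add_zero] at h2
  simpa [h2] using h1

variable {B : Module.Basis (ℕ × ℕ) F A} (hB : ∀ i j, B (i, j) = leftMonomial F e f i j)
include hB

theorem repr_associator_right_left {n i j : ℕ} {x : A}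
    (hx : x ∈ monomialFiltration F e f (n + 1)) (hij : i + j = n) :
    B.repr (associator x f e) (i, j) = -(i : F) * B.repr x (i, j) := by
  refine repr_apply_eq_of_mem (associatorLinear F f e) (-(i : F) • B.coord (i, j))
    (fun k l hkl => ?_) hx
  have h1 := repr_eq_zero_of_mem hB (h.associator_leftMonomial_right_left_add_mem k l)
    (i := i) (j := j) (by omega)
  rw [map_add, map_smul, Finsupp.add_apply, Finsupp.smul_apply, repr_leftMonomial hB] at h1
  rw [associatorLinear_apply, eq_neg_of_add_eq_zero_left h1, LinearMap.smul_apply,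
    B.coord_apply, repr_leftMonomial hB]
  by_cases hp : (k, l) = (i, j)
  · obtain ⟨rfl, rfl⟩ := Prod.mk.inj hp
    simp
  · simp [Finsupp.single_eq_of_ne' hp]

theorem repr_associator_left_left_succ {n i j : ℕ} {x : A}
    (hx : x ∈ monomialFiltration F e f (n + 1)) (hij : i + 1 + j = n) :
    B.repr (associator x e e) (i + 1, j) = ((j : F) + 1) * B.repr x (i, j + 1) := by
  refine repr_apply_eq_of_mem (associatorLinear F e e) (((j : F) + 1) • B.coord (i, j + 1))
    (fun k l hkl => ?_) hx
  have h1 := repr_eq_zero_of_mem hB (h.associator_leftMonomial_left_sub_mem k l)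
    (i := i + 1) (j := j) (by omega)
  rw [map_sub, map_smul, Finsupp.sub_apply, Finsupp.smul_apply, repr_leftMonomial hB,
    sub_eq_zero] at h1
  rw [associatorLinear_apply, h1, LinearMap.smul_apply, B.coord_apply, repr_leftMonomial hB]
  rcases l with - | l
  · simp
  by_cases hp : (k, l) = (i, j)
  · obtain ⟨rfl, rfl⟩ := Prod.mk.inj hp
    simp
  · rw [Finsupp.single_eq_of_ne' (by simpa using hp), Finsupp.single_eq_of_ne' (by simpa using hp)]
    simp

theorem repr_associator_left_left_zero {n : ℕ} {x : A}
    (hx : x ∈ monomialFiltration F e f (n + 1)) : B.repr (associator x e e) (0, n) = 0 := by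
  refine repr_apply_eq_of_mem (associatorLinear F e e) 0 (fun k l hkl => ?_) hx
  have h1 := repr_eq_zero_of_mem hB (h.associator_leftMonomial_left_sub_mem k l)
    (i := 0) (j := n) (by omega)
  rw [map_sub, map_smul, Finsupp.sub_apply, Finsupp.smul_apply, repr_leftMonomial hB,
    Finsupp.single_eq_of_ne' (by simp), smul_zero, sub_zero] at h1
  exact h1

/-- In a right ideal, a nonzero element of degree at most `n` can be moved to one whose leading
term is a multiple of `eⁿ`. -/
theorem exists_leading_power {I : Submodule F A} (hI : IsRightIdeal I) {n : ℕ} (J : ℕ) {x : A}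
    (hxI : x ∈ I) (hx : x ∈ monomialFiltration F e f (n + 1)) (hx0 : x ≠ 0)
    (hJ : ∀ i j, i + j = n → J < j → B.repr x (i, j) = 0) :
    ∃ z ∈ I, z ∈ monomialFiltration F e f (n + 1) ∧ z ≠ 0 ∧
      ∀ i j, i + j = n → 0 < j → B.repr z (i, j) = 0 := by
  induction J generalizing x with
  | zero => exact ⟨x, hxI, hx, hx0, hJ⟩
  | succ J ih =>
    by_cases hc : ∀ i, i + (J + 1) = n → B.repr x (i, J + 1) = 0
    · refine ih hxI hx hx0 fun i j hij hj => ?_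
      rcases (Nat.succ_le_of_lt hj).eq_or_lt with rfl | hj
      exacts [hc i hij, hJ i j hij hj]
    · push Not at hc
      obtain ⟨k, hk, hc⟩ := hc
      -- The operator `e ∂_f` lowers the largest exponent of `f` by one; its factor `J + 1` is
      -- nonzero in characteristic zero, so the result is nonzero.
      refine ih (hI.associator_mem hxI e e)
        (h.associator_mem (.inl rfl) hx left_mem_monomialFiltration) (fun h0 => ?_)
        fun i j hij hj => ?_
      · have h1 := h.repr_associator_left_left_succ hB hx (i := k) (j := J) (by omega)
        rw [h0, map_zero, Finsupp.zero_apply, eq_comm, mul_eq_zero] at h1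
        exact h1.elim (by exact_mod_cast J.succ_ne_zero) hc
      · rcases i with - | i
        · obtain rfl : j = n := by omega
          exact h.repr_associator_left_left_zero hB hx
        · rw [h.repr_associator_left_left_succ hB hx hij, hJ i (j + 1) (by omega) (by omega),
            mul_zero]

/-- In degree less than `N` the map `(·,f,e)` is triangular with diagonal entries `-i`, `i < N`, so
`-N` is not an eigenvalue. -/
theorem eq_zero_of_associator_eq {N n : ℕ} (hn : n ≤ N) {u : A}
    (hu : u ∈ monomialFiltration F e f n) (h0 : associator u f e = -(N : F) • u) : u = 0 := by
  induction n with
  | zero => rwa [monomialFiltration_zero, Submodule.mem_bot] at hu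
  | succ n ih =>
    refine ih (by omega) (mem_monomialFiltration_of_succ hB hu fun i j hij => ?_)
    have h1 := h.repr_associator_right_left hB hu hij
    rw [h0, map_smul, Finsupp.smul_apply, smul_eq_mul, ← sub_eq_zero, ← sub_mul,
      mul_eq_zero] at h1
    refine h1.resolve_left fun h2 => ?_
    have h3 : (i : F) = N := by linear_combination h2
    have h4 : i = N := by exact_mod_cast h3
    omega

theorem left_mem_of_isRightIdeal {I : Submodule F A} (hI : IsRightIdeal I) (hbot : I ≠ ⊥)
    (hone : (1 : A) ∉ I) : e ∈ I := by
  classical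
  obtain ⟨x, hxI, hx0⟩ := I.ne_bot_iff.1 hbot
  have hex : ∃ n, ∃ x ∈ I, x ≠ 0 ∧ x ∈ monomialFiltration F e f n := by
    obtain ⟨n, hn⟩ := exists_mem_supportedBelow (B.repr x)
    exact ⟨n, x, hxI, hx0, (mem_monomialFiltration_iff hB).2 hn⟩
  obtain ⟨N, hN⟩ : ∃ N, Nat.find hex = N + 1 := by
    refine Nat.exists_eq_succ_of_ne_zero fun h0 => ?_
    obtain ⟨x, -, hx0, hx⟩ := Nat.find_spec hex
    rw [h0, monomialFiltration_zero, Submodule.mem_bot] at hx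
    exact hx0 hx
  have hmin : ∀ x ∈ I, x ∈ monomialFiltration F e f N → x = 0 := fun x hxI hx => by
    by_contra hx0
    have := Nat.find_min' hex ⟨x, hxI, hx0, hx⟩
    omega
  obtain ⟨x, hxI, hx0, hx⟩ := Nat.find_spec hex
  rw [hN] at hx
  obtain ⟨z, hzI, hz, hz0, hzc⟩ := h.exists_leading_power hB hI N hxI hx hx0
    fun i j hij hj => by omega
  -- The leading multiple of `e^N` cancels, so this element of the ideal has degree below the
  -- minimum.
  have h1 : associator z f e + (N : F) • z = 0 := by
    refine hmin _ (add_mem (hI.associator_mem hzI f e) (Submodule.smul_mem _ _ hzI)) ?_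
    refine mem_monomialFiltration_of_succ hB (add_mem (h.associator_mem (.inr rfl) hz
      left_mem_monomialFiltration) (Submodule.smul_mem _ _ hz)) fun i j hij => ?_
    rw [map_add, map_smul, Finsupp.add_apply, Finsupp.smul_apply,
      h.repr_associator_right_left hB hz hij]
    rcases j with - | j
    · subst hij
      simp
    · rw [hzc i _ hij (by omega)]
      simp
  -- Both `z` and `e^N` are eigenvectors for `-N`, and their leading terms cancel, leaving no room
  -- for a remainder.
  have h2 : z - B.repr z (N, 0) • leftMonomial F e f N 0 = 0 := by
    refine h.eq_zero_of_associator_eq hB le_rfl (mem_monomialFiltration_of_succ hB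
      (sub_mem hz (Submodule.smul_mem _ _ (leftMonomial_mem (by omega)))) fun i j hij => ?_) ?_
    · rw [map_sub, map_smul, Finsupp.sub_apply, Finsupp.smul_apply, repr_leftMonomial hB]
      rcases j with - | j
      · obtain rfl : i = N := hij
        simp
      · rw [hzc i _ hij (by omega), Finsupp.single_eq_of_ne' (by simp)]
        simp
    · rw [← associatorLinear_apply (F := F), map_sub, map_smul, associatorLinear_apply,
        associatorLinear_apply, eq_neg_of_add_eq_zero_left h1,
        h.associator_leftMonomial_right_left]
      module
  have hpow : leftMonomial F e f N 0 ∈ I := by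
    have hc : B.repr z (N, 0) ≠ 0 := fun hc => by
      rw [hc, zero_smul, sub_zero] at h2
      exact hz0 h2
    rw [sub_eq_zero] at h2
    rwa [h2, Submodule.smul_mem_iff _ hc] at hzI
  rcases N with - | N
  · exact absurd hpow hone
  rcases N with - | N
  · rwa [zero_add, leftMonomial_one_zero] at hpow
  exfalso
  have h3 := h.associator_naPow_mul (N + 2)
  rw [naPow_eq_leftMonomial (F := F) e f, naPow_eq_leftMonomial (F := F) e f] at h3
  -- With `n` the current exponent, `n e^n f - (e^n,f,f)e = n(n-1)e^{n-1}` lies in the ideal,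
  -- against minimality.
  have h4 := sub_mem (Submodule.smul_mem I ((N + 2 : ℕ) : F) (hI _ hpow f))
    (hI _ (hI.associator_mem hpow f f) e)
  rw [h3, sub_sub_cancel, Submodule.smul_mem_iff] at h4
  · have h5 := hmin _ h4 (leftMonomial_mem (by omega))
    rw [← hB] at h5
    exact B.ne_zero _ h5
  · refine mul_ne_zero (Nat.cast_ne_zero.2 (by omega)) ?_
    push_cast
    have : ((N + 1 : ℕ) : F) ≠ 0 := Nat.cast_ne_zero.2 (by omega)
    push_cast at this
    rwa [add_sub_assoc, show (2 : F) - 1 = 1 by norm_num]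

end IsS2Pair

end RightIdeals

/-! ### The monomial basis of `U(S₂)` and its right ideals. -/

namespace EnvelopingAlgebra

variable {F : Type*} [Field F] {T : Type*} [AddCommGroup T] [Module F T] [LieTripleSystem F T]

/-- A subspace of `U(T)` which contains `1` and `T` and is closed under products is everything. -/
theorem eq_top_of_mul_mem {S : Submodule F (EnvelopingAlgebra F T)} (hone : 1 ∈ S)
    (hι : ∀ a : T, ι F a ∈ S) (hmul : ∀ x ∈ S, ∀ y ∈ S, x * y ∈ S) : S = ⊤ := by
  have key : ∀ m : FreeMagma T,
      mk (MonoidAlgebra.single (m : WithOne (FreeMagma T)) (1 : F)) ∈ S := by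
    intro m
    induction m using FreeMagma.recOnMul with
    | ih1 a => exact hι a
    | ih2 x y hx hy =>
      have := hmul _ hx _ hy
      rwa [← mk_mul, MonoidAlgebra.single_mul_single, one_mul, ← WithOne.coe_mul] at this
  refine eq_top_iff.2 fun x _ => ?_
  obtain ⟨x, rfl⟩ := mk_surjective x
  induction x using MonoidAlgebra.induction_linear with
  | zero => exact zero_mem S
  | add x y hx hy => exact add_mem (hx trivial) (hy trivial)
  | single m r =>
    have h1 : (MonoidAlgebra.single m r : FreeUnitalNonAssocAlgebra F T) =
        r • MonoidAlgebra.single m 1 := by simp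
    rw [h1, mk_smul]
    refine Submodule.smul_mem _ _ ?_
    exact WithOne.cases_on m hone key

end EnvelopingAlgebra

namespace S2

open EnvelopingAlgebra

variable {F : Type*} [Field F]

variable (F) in
theorem isS2Pair : IsS2Pair F (ι F (e F)) (ι F (f F)) where
  left_mem := isSpecialMap_ι.mem_leftAltNucleus _
  right_mem := isSpecialMap_ι.mem_leftAltNucleus _
  comm := isSpecialMap_ι.comm _ _
  bracket_left := by rw [← isSpecialMap_ι.map_bracket, bracket_e_f_e, map_smul]
  bracket_right := by rw [← isSpecialMap_ι.map_bracket, bracket_e_f_f, map_smul]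

theorem eq_smul_e_add_smul_f (a : S2 F) : a = a.1 • e F + a.2 • f F :=
  Prod.ext
    (by rw [add_fst, smul_fst, smul_fst]; change a.1 = a.1 * 1 + a.2 * 0; ring)
    (by rw [add_snd, smul_snd, smul_snd]; change a.2 = a.1 * 0 + a.2 * 1; ring)

variable [CharZero F]

variable (F) in
theorem span_leftMonomial :
    Submodule.span F (Set.range fun p : ℕ × ℕ =>
      leftMonomial F (ι F (e F)) (ι F (f F)) p.1 p.2) = ⊤ := by
  set S := Submodule.span F (Set.range fun p : ℕ × ℕ =>
      leftMonomial F (ι F (e F)) (ι F (f F)) p.1 p.2) with hS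
  have hmem : ∀ i j, leftMonomial F (ι F (e F)) (ι F (f F)) i j ∈ S := fun i j =>
    Submodule.subset_span ⟨(i, j), rfl⟩
  have hle : ∀ n, monomialFiltration F (ι F (e F)) (ι F (f F)) n ≤ S := fun n =>
    Submodule.span_le.2 (by rintro _ ⟨i, j, -, rfl⟩; exact hmem i j)
  refine eq_top_of_mul_mem (hmem 0 0) (fun a => ?_) fun x hx y hy => ?_
  · rw [eq_smul_e_add_smul_f a, map_add, map_smul, map_smul]
    have h1 := hmem 1 0
    have h2 := hmem 0 1
    rw [leftMonomial_one_zero] at h1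
    rw [leftMonomial_zero_one] at h2
    exact add_mem (Submodule.smul_mem _ _ h1) (Submodule.smul_mem _ _ h2)
  · induction hx using Submodule.span_induction with
    | mem x hx =>
      induction hy using Submodule.span_induction with
      | mem y hy =>
        obtain ⟨⟨i, j⟩, rfl⟩ := hx
        obtain ⟨⟨k, l⟩, rfl⟩ := hy
        exact hle _ ((isS2Pair F).mul_mem (leftMonomial_mem (n := i + j + 1) (by omega))
          (leftMonomial_mem (n := k + l + 1) (by omega)))
      | zero => rw [mul_zero]; exact zero_mem _
      | add y z _ _ hy hz => rw [mul_add]; exact add_mem hy hz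
      | smul r y _ hy => rw [mul_smul_comm]; exact Submodule.smul_mem _ _ hy
    | zero => rw [zero_mul]; exact zero_mem _
    | add x z _ _ hx hz => rw [add_mul]; exact add_mem hx hz
    | smul r x _ hx => rw [smul_mul_assoc]; exact Submodule.smul_mem _ _ hx

variable (F) in
/-- The homomorphism from `U(S₂)` to its concrete model. -/
noncomputable def toModel : EnvelopingAlgebra F (S2 F) →ₙₐ[F] S2Model F :=
  lift (S2Model.incl F) S2Model.isSpecialMap_incl

theorem toModel_e_mul (x : EnvelopingAlgebra F (S2 F)) :
    toModel F (ι F (e F) * x) = S2Model.opE F (toModel F x) := by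
  rw [map_mul, toModel, lift_ι, S2Model.incl_mul]
  change (1 : F) • _ + (0 : F) • _ = _
  rw [one_smul, zero_smul, add_zero]

theorem toModel_f_mul (x : EnvelopingAlgebra F (S2 F)) :
    toModel F (ι F (f F) * x) = S2Model.opF F (toModel F x) := by
  rw [map_mul, toModel, lift_ι, S2Model.incl_mul]
  change (0 : F) • _ + (1 : F) • _ = _
  rw [one_smul, zero_smul, zero_add]

theorem toModel_leftMonomial (i j : ℕ) :
    toModel F (leftMonomial F (ι F (e F)) (ι F (f F)) i j) = S2Model.vec F i j := by
  induction i with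
  | zero =>
    induction j with
    | zero => exact lift_one _ _
    | succ j ih => rw [← right_mul_leftMonomial_zero, toModel_f_mul, ih, S2Model.vec_zero_succ]
  | succ i ih => rw [← left_mul_leftMonomial, toModel_e_mul, ih, S2Model.opE_vec]

variable (F) in
-- The homomorphism to the model sends these monomials to its basis.
theorem linearIndependent_leftMonomial :
    LinearIndependent F fun p : ℕ × ℕ => leftMonomial F (ι F (e F)) (ι F (f F)) p.1 p.2 := by
  refine LinearIndependent.of_comp (toModel F : EnvelopingAlgebra F (S2 F) →ₗ[F] S2Model F) ?_
  have h1 : (toModel F : EnvelopingAlgebra F (S2 F) →ₗ[F] S2Model F) ∘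
      (fun p : ℕ × ℕ => leftMonomial F (ι F (e F)) (ι F (f F)) p.1 p.2) = S2Model.basis F :=
    funext fun p => (toModel_leftMonomial p.1 p.2).trans (S2Model.basis_apply p).symm
  rw [h1]
  exact (S2Model.basis F).linearIndependent

variable (F) in
/-- The Poincaré–Birkhoff–Witt basis of `U(S₂)`. -/
noncomputable def leftMonomialBasis : Module.Basis (ℕ × ℕ) F (EnvelopingAlgebra F (S2 F)) :=
  Module.Basis.mk (linearIndependent_leftMonomial F) (span_leftMonomial F).ge

theorem leftMonomialBasis_apply (i j : ℕ) :
    leftMonomialBasis F (i, j) = leftMonomial F (ι F (e F)) (ι F (f F)) i j :=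
  Module.Basis.mk_apply _ _ _

omit [CharZero F] in
theorem counit_ι (a : S2 F) : counit F (S2 F) (ι F a) = 0 := lift_ι _ _ a

omit [CharZero F] in
theorem counit_one : counit F (S2 F) 1 = 1 := lift_one _ _

omit [CharZero F] in
theorem mem_augmentationIdeal {x : EnvelopingAlgebra F (S2 F)} :
    x ∈ augmentationIdeal F (S2 F) ↔ counit F (S2 F) x = 0 := Iff.rfl

/-- Every monomial other than `1` is `e` or `f` times something, so it lies in `I` and is killed by
the counit. -/
theorem augmentationIdeal_le {I : Submodule F (EnvelopingAlgebra F (S2 F))} (hI : IsRightIdeal I)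
    (he : ι F (e F) ∈ I) (hf : ι F (f F) ∈ I) : augmentationIdeal F (S2 F) ≤ I := by
  have key : ∀ x, x - counit F (S2 F) x • (1 : EnvelopingAlgebra F (S2 F)) ∈ I := by
    intro x
    have hx : x ∈ Submodule.span F (Set.range fun p : ℕ × ℕ =>
      leftMonomial F (ι F (e F)) (ι F (f F)) p.1 p.2) := span_leftMonomial F ▸ Submodule.mem_top
    induction hx using Submodule.span_induction with
    | mem x hx =>
      obtain ⟨⟨i, j⟩, rfl⟩ := hx
      dsimp only
      rcases i with - | i
      · rcases j with - | j
        · change (1 : EnvelopingAlgebra F (S2 F)) - counit F (S2 F) 1 • 1 ∈ I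
          rw [counit_one, one_smul, sub_self]
          exact zero_mem _
        · rw [← right_mul_leftMonomial_zero, map_mul, counit_ι, zero_mul, zero_smul, sub_zero]
          exact hI _ hf _
      · rw [← left_mul_leftMonomial, map_mul, counit_ι, zero_mul, zero_smul, sub_zero]
        exact hI _ he _
    | zero => simp
    | add x y _ _ hx hy =>
      convert add_mem hx hy using 1
      rw [map_add]
      module
    | smul r x _ hx =>
      convert Submodule.smul_mem _ r hx using 1
      rw [map_smul, smul_eq_mul]
      module
  intro x hx
  have := key x
  rwa [mem_augmentationIdeal.1 hx, zero_smul, sub_zero] at this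

theorem isRightIdeal_iff_eq_augmentationIdeal (I : Submodule F (EnvelopingAlgebra F (S2 F))) :
    (IsRightIdeal I ∧ I ≠ ⊥ ∧ I ≠ ⊤) ↔ I = augmentationIdeal F (S2 F) := by
  constructor
  · rintro ⟨hI, hbot, htop⟩
    have hone : (1 : EnvelopingAlgebra F (S2 F)) ∉ I := fun h1 =>
      htop (eq_top_iff.2 fun x _ => by simpa using hI 1 h1 x)
    have he := (isS2Pair F).left_mem_of_isRightIdeal leftMonomialBasis_apply hI hbot hone
    have hf : ι F (f F) ∈ I := by
      -- The case `n = 1` reads `(e,f,f) = f`.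
      have h1 := (isS2Pair F).associator_leftMonomial_right_right 1
      rw [leftMonomial_one_zero, Nat.sub_self, leftMonomial_zero_one, Nat.cast_one, one_smul] at h1
      exact h1 ▸ hI.associator_mem he _ _
    have hle := augmentationIdeal_le hI he hf
    refine le_antisymm (fun x hx => ?_) hle
    rw [mem_augmentationIdeal]
    by_contra hc
    -- An element of `I` outside the kernel would put a nonzero multiple of `1` in `I`.
    have h1 : x - counit F (S2 F) x • (1 : EnvelopingAlgebra F (S2 F)) ∈ I := hle (by
      rw [mem_augmentationIdeal, map_sub, map_smul, counit_one, smul_eq_mul, mul_one, sub_self])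
    have h2 := sub_mem hx h1
    rw [sub_sub_cancel, Submodule.smul_mem_iff _ hc] at h2
    exact hone h2
  · rintro rfl
    refine ⟨fun x hx a => ?_, fun h0 => ?_, fun h0 => ?_⟩
    · rw [mem_augmentationIdeal, map_mul, mem_augmentationIdeal.1 hx, zero_mul]
    · have h1 : ι F (e F) ∈ augmentationIdeal F (S2 F) := counit_ι _
      rw [h0, Submodule.mem_bot, ← leftMonomial_one_zero (F := F) (ι F (e F)) (ι F (f F)),
        ← leftMonomialBasis_apply] at h1
      exact (leftMonomialBasis F).ne_zero _ h1
    · have h1 : (1 : EnvelopingAlgebra F (S2 F)) ∈ augmentationIdeal F (S2 F) :=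
        h0 ▸ Submodule.mem_top
      rw [mem_augmentationIdeal, counit_one] at h1
      exact one_ne_zero h1

end S2

theorem mainTheorem3 {F : Type*} [Field F] [CharZero F] (e f : EnvelopingAlgebra F (S2 F))
    (he : e = EnvelopingAlgebra.ι F (S2.e F)) (hf : f = EnvelopingAlgebra.ι F (S2.f F)) :
    (∀ n : ℕ, associator (naPow e n) f f * e =
      (n : F) • (naPow e n * f) - ((n : F) * ((n : F) - 1)) • naPow e (n - 1)) ∧
    (∀ I : Submodule F (EnvelopingAlgebra F (S2 F)),
      (IsRightIdeal I ∧ I ≠ ⊥ ∧ I ≠ ⊤) ↔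
        I = EnvelopingAlgebra.augmentationIdeal F (S2 F)) := by
  subst he hf
  exact ⟨(S2.isS2Pair F).associator_naPow_mul, S2.isRightIdeal_iff_eq_augmentationIdeal⟩
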